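/- Let $\varphi_k(t)=\sqrt{k+1/2}\,(2^kk!)^{-1}\frac{d^k}{dt^k}(t^2-1)^k$, $k=0,1,\dots$, be the orthonormal Legendre polynomials on $[-1,1]$, let $L_2=L_2(Q)$ be the real Hilbert space of square-integrable functions on $Q=[-1,1]^2$, and let $\varphi_{k,j}(t,\tau)=\varphi_k(t)\varphi_j(\tau)$. Write $\underline{k}=\max\{1,k\}$ and let $$L^{\overline\mu}_{s,2}=\Big\{f\in L_2:\ \sum_{k,j\ge0}\underline{k}^{s\mu_1}\underline{j}^{s\mu_2}|\langle f,\varphi_{k,j}\rangle|^s\le 1\Big\},\qquad \overline\mu=(\mu_1,\mu_2).$$ For an integer $r\ge1$ let $f^{(0,r)}=\sum_{k\ge0}\sum_{j\ge r}\langle f,\varphi_{k,j}\rangle\varphi_k(t)\varphi_j^{(r)}(\tau)$ (the sum in $L_2$). For $1\le p\le\infty$ and $0<\delta<1$, admissible data for $f$ are the sequences $f^\delta=(f^\delta_{k,j})_{k,j\ge0}$ of reals with $\|(\langle f,\varphi_{k,j}\rangle-f^\delta_{k,j})_{k,j}\|_{\ell_p}\le\delta$. For a finite set $\Omega\subset\{(k,j)\in\mathbb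 N_0^2:\ j\ge r\}$ and an arbitrary map $\psi:\mathbb R^{\Omega}\to L_2$ put $$\varepsilon_\delta(\psi)=\sup_{f\in L^{\overline\mu}_{s,2}}\ \sup_{f^\delta}\ \big\|f^{(0,r)}-\psi\big((f^\delta_{k,j})_{(k,j)\in\Omega}\big)\big\|_{L_2},\qquad R_{N,\delta}=\inf_{\operatorname{card}\Omega\le N}\ \inf_{\psi:\mathbb R^\Omega\to L_2}\varepsilon_\delta(\psi),$$ the suprema being over $f\in L^{\overline\mu}_{s,2}$ and over all admissible data $f^\delta$ for $f$; $R_{N,\delta}=R^{(0,r)}_{N,\delta}(L^{\overline\mu}_{s,2},L_2,\ell_p)$ is the minimal radius of Galerkin information. For $\gamma\ge1$ and $n\in\mathbb N$ let $\Gamma_{n,\gamma}=\{(k,j):\ k^\gamma j\le n,\ 0\le k\le n^{1/\gamma},\ r\le j\le n\}$ and let the truncation method be $$\mathcal D_{n,\gamma}f^\delta=\sum_{(k,j)\in\Gamma_{n,\gamma}}f^\delta_{k,j}\,\varphi_k(t)\varphi_j^{(r)}(\tau),$$ with error $\varepsilon_\delta(\mathcal D_{n,\gamma})$. **Theorem.**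 Let $r\ge1$ be an integer, $2\le s<\infty$, $1\le p\le\infty$, $\mu_2>2r-1/s+1/2$, $\mu_1>\mu_2-2r$, and put $a=\mu_2-1/p+1/s$, $\beta=\mu_2-2r+1/s-1/2$ (so $a,\beta>0$, with $1/p=0$ for $p=\infty$). For every $f\in L^{\overline\mu}_{s,2}$ the series of $f^{(0,r)}$ converges unconditionally in $L_2$. Moreover, with all constants independent of $\delta$, $N$, $n$ (they may depend on $r,s,p,\mu_1,\mu_2,\gamma$ and on the constants in the hypotheses $N\asymp\dots$, $n\asymp\dots$), the following holds. a) If $N\asymp\delta^{-1/a}$, $0<\delta<1$, then $$R_{N,\delta}\asymp N^{-\beta}=N^{-\mu_2+2r-1/s+1/2}\asymp\delta^{\beta/a}=\delta^{\frac{\mu_2-2r+1/s-1/2}{\mu_2-1/p+1/s}}.$$ These order-optimal estimates are attained by $\mathcal D_{n,\gamma}$ with $n\asymp\delta^{-1/a}$ and $1<\gamma<\frac{\mu_1+1/s-1/2}{\mu_2-2r+1/s-1/2}$: for all such $n$ and all $0<\delta<1$ one has $\varepsilon_\delta(\mathcal D_{n,\gamma})\le C\delta^{\beta/a}$; for all sufficiently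 small $\delta$ one has $\operatorname{card}\Gamma_{n,\gamma}\asymp\delta^{-1/a}$; and for all sufficiently small $\delta$ and every $N\asymp\delta^{-1/a}$ there is $n\asymp\delta^{-1/a}$ with $\operatorname{card}\Gamma_{n,\gamma}\le N$. b) If $N\asymp\delta^{-1/a}\ln\frac1\delta$, $N\ge2$, $0<\delta<1$, then $$C_1N^{-\beta}\le R_{N,\delta}\le C_2(N/\ln N)^{-\beta}\quad\text{and}\quad C_1\,\delta^{\beta/a}\ln^{-\beta}\tfrac1\delta\le R_{N,\delta}\le C_2\,\delta^{\beta/a}$$ with constants $C_1,C_2>0$. The upper bounds are attained by $\mathcal D_{n,1}$ with $n\asymp\delta^{-1/a}$: for all such $n$ and all $0<\delta<1$ one has $\varepsilon_\delta(\mathcal D_{n,1})\le C\delta^{\beta/a}$; for all sufficiently small $\delta$ one has $\operatorname{card}\Gamma_{n,1}\asymp\delta^{-1/a}\ln\frac1\delta$; and for all sufficiently small $\delta$ and every $N\asymp\delta^{-1/a}\ln\frac1\delta$ there is $n\asymp\delta^{-1/a}$ with $\operatorname{card}\Gamma_{n,1}\le N$. -/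

import Mathlib

open MeasureTheory Set
open scoped ENNReal Polynomial

noncomputable section

namespace NumDiff

/-- The square `Q = [-1,1]²`. -/
def Q : Set (ℝ × ℝ) := Icc (-1 : ℝ) 1 ×ˢ Icc (-1 : ℝ) 1

/-- The real Hilbert space `L₂(Q)` (Lebesgue measure on `Q`). -/
abbrev L2Q : Type := Lp ℝ 2 ((volume : Measure (ℝ × ℝ)).restrict Q)

/-- The Legendre polynomial of degree `k`, orthonormal on `[-1,1]` (Rodrigues' formula):
`φ_k(t) = √(k+1/2) (2^k k!)⁻¹ (d/dt)^k (t²-1)^k`. -/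
def legendre (k : ℕ) : ℝ[X] :=
  Polynomial.C (Real.sqrt ((k : ℝ) + 1 / 2) * ((2 : ℝ) ^ k * (k.factorial : ℝ))⁻¹) *
    Polynomial.derivative^[k] ((Polynomial.X ^ 2 - 1) ^ k)

theorem memLp_tensor (u v : ℝ[X]) :
    MemLp (fun x : ℝ × ℝ => u.eval x.1 * v.eval x.2) 2
      ((volume : Measure (ℝ × ℝ)).restrict Q) := by
  have hQ : IsCompact Q := isCompact_Icc.prod isCompact_Icc
  have hc : Continuous (fun x : ℝ × ℝ => u.eval x.1 * v.eval x.2) := by fun_prop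
  have : IsFiniteMeasure ((volume : Measure (ℝ × ℝ)).restrict Q) :=
    ⟨by rw [Measure.restrict_apply_univ]; exact hQ.measure_lt_top⟩
  obtain ⟨C, hC⟩ := hQ.exists_bound_of_continuousOn hc.continuousOn
  refine MemLp.of_bound hc.aestronglyMeasurable C ?_
  exact (ae_restrict_iff' hQ.measurableSet).2 (Filter.Eventually.of_forall hC)

/-- The function `(t,τ) ↦ u(t) v(τ)` as an element of `L₂(Q)`. -/
def tensor (u v : ℝ[X]) : L2Q := (memLp_tensor u v).toLp

/-- The Fourier–Legendre coefficient `⟨f, φ_{k,j}⟩` for `q = (k,j)`. -/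
def coef (f : L2Q) (q : ℕ × ℕ) : ℝ := inner ℝ f (tensor (legendre q.1) (legendre q.2))

/-- The `(k,j)`-th term of the series defining `‖f‖_{s,μ}^s`; here `max 1 k` is `k` underlined. -/
def weightedTerm (s μ₁ μ₂ : ℝ) (f : L2Q) (q : ℕ × ℕ) : ℝ :=
  (max 1 (q.1 : ℝ)) ^ (s * μ₁) * (max 1 (q.2 : ℝ)) ^ (s * μ₂) * |coef f q| ^ s

/-- The norm `‖f‖_{s,μ}`, meaningful when the defining series converges. -/
def classNorm (s μ₁ μ₂ : ℝ) (f : L2Q) : ℝ :=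
  (∑' q : ℕ × ℕ, weightedTerm s μ₁ μ₂ f q) ^ (1 / s)

/-- The class `L^μ_{s,2}`: the unit ball of the space of `f ∈ L₂(Q)` with `‖f‖_{s,μ} < ∞`. -/
def functionClass (s μ₁ μ₂ : ℝ) : Set L2Q :=
  {f | Summable (weightedTerm s μ₁ μ₂ f) ∧ classNorm s μ₁ μ₂ f ≤ 1}

/-- `φ_k(t) φ_j^{(r)}(τ)` for `q = (k,j)`, as an element of `L₂(Q)`. -/
def derivTensor (r : ℕ) (q : ℕ × ℕ) : L2Q :=
  tensor (legendre q.1) (Polynomial.derivative^[r] (legendre q.2))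

/-- The terms of the series `f^{(0,r)} = ∑_{k ≥ 0} ∑_{j ≥ r} ⟨f,φ_{k,j}⟩ φ_k(t) φ_j^{(r)}(τ)`. -/
def derivTerm (r : ℕ) (f : L2Q) (q : {q : ℕ × ℕ // r ≤ q.2}) : L2Q :=
  coef f q.1 • derivTensor r q.1

/-- The derivative `f^{(0,r)}`, the sum in `L₂(Q)` of its series
(meaningful when the series converges). -/
def partialDeriv (r : ℕ) (f : L2Q) : L2Q := ∑' q, derivTerm r f q

/-- `g` is an admissible sequence of perturbed coefficients of `f`:
`‖(⟨f,φ_{k,j}⟩ - g_{k,j})_{k,j}‖_{ℓ_p} ≤ δ`. -/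
def IsPerturbation (p : ℝ≥0∞) (δ : ℝ) (f : L2Q) (g : ℕ × ℕ → ℝ) : Prop :=
  ∃ ξ : lp (fun _ : ℕ × ℕ => ℝ) p, ‖ξ‖ ≤ δ ∧ ∀ q, ξ q = coef f q - g q

/-- The information vector `G(Ω, g)`. -/
def info (Ω : Finset (ℕ × ℕ)) (g : ℕ × ℕ → ℝ) : Ω → ℝ := fun q => g q.1

/-- The worst-case error `ε_δ` in `L₂(Q)` of the algorithm `ψ` that uses the coefficients
with indices in `Ω`. -/
def algError (r : ℕ) (s μ₁ μ₂ : ℝ) (p : ℝ≥0∞) (δ : ℝ) (Ω : Finset (ℕ × ℕ))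
    (ψ : (Ω → ℝ) → L2Q) : ℝ≥0∞ :=
  ⨆ f ∈ functionClass s μ₁ μ₂, ⨆ (g : ℕ × ℕ → ℝ) (_ : IsPerturbation p δ f g),
    ‖partialDeriv r f - ψ (info Ω g)‖ₑ

/-- The minimal radius of Galerkin information `R^{(0,r)}_{N,δ}(L^μ_{s,2}, L₂, ℓ_p)`: the infimum
over index sets `Ω ⊆ [0,∞) × [r,∞)` with at most `N` points and over all maps `ψ`. -/
def minRadius (r : ℕ) (s μ₁ μ₂ : ℝ) (p : ℝ≥0∞) (N : ℕ) (δ : ℝ) : ℝ≥0∞ :=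
  ⨅ (Ω : Finset (ℕ × ℕ)) (_ : (∀ q ∈ Ω, r ≤ q.2) ∧ Ω.card ≤ N) (ψ : (Ω → ℝ) → L2Q),
    algError r s μ₁ μ₂ p δ Ω ψ

open Classical in
/-- The hyperbolic cross
`Γ_{n,γ} = {(k,j) : k^γ j ≤ n, 0 ≤ k ≤ n^{1/γ}, r ≤ j ≤ n}`
(for `γ ≥ 1` the box `k < n + 1` is no further restriction, see `mem_hyperbolicCross`). -/
def hyperbolicCross (r n : ℕ) (γ : ℝ) : Finset (ℕ × ℕ) :=
  (Finset.range (n + 1) ×ˢ Finset.Icc r n).filter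
    (fun q => (q.1 : ℝ) ^ γ * (q.2 : ℝ) ≤ (n : ℝ) ∧ (q.1 : ℝ) ≤ (n : ℝ) ^ (1 / γ))

theorem mem_hyperbolicCross (r n : ℕ) (γ : ℝ) (hγ : 1 ≤ γ) (q : ℕ × ℕ) :
    q ∈ hyperbolicCross r n γ ↔ (q.1 : ℝ) ^ γ * (q.2 : ℝ) ≤ (n : ℝ) ∧
      (q.1 : ℝ) ≤ (n : ℝ) ^ (1 / γ) ∧ r ≤ q.2 ∧ q.2 ≤ n := by
  have key : (q.1 : ℝ) ≤ (n : ℝ) ^ (1 / γ) → q.1 < n + 1 := by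
    intro h
    have h0 : 0 < 1 / γ := by positivity
    have h1 : 1 / γ ≤ 1 := by rw [div_le_one (by linarith)]; exact hγ
    have : (q.1 : ℝ) ≤ n := by
      rcases Nat.eq_zero_or_pos n with hn | hn
      · subst hn
        rw [Nat.cast_zero, Real.zero_rpow h0.ne'] at h
        simpa using h
      · exact h.trans (Real.rpow_le_self_of_one_le (by exact_mod_cast hn) h1)
    have : q.1 ≤ n := by exact_mod_cast this
    omega
  simp only [hyperbolicCross, Finset.mem_filter, Finset.mem_product, Finset.mem_range,
    Finset.mem_Icc]
  tauto

/-- The truncation method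
`D^{(0,r)}_{n,γ} f^δ = ∑_{(k,j) ∈ Γ_{n,γ}} f^δ_{k,j} φ_k(t) φ_j^{(r)}(τ)`
as an algorithm using the coefficients with indices in `Γ_{n,γ}`. -/
def truncation (r n : ℕ) (γ : ℝ) (y : hyperbolicCross r n γ → ℝ) : L2Q :=
  ∑ q, y q • derivTensor r q.1

/-- The worst-case error of the truncation method. -/
def truncationError (r : ℕ) (s μ₁ μ₂ : ℝ) (p : ℝ≥0∞) (δ : ℝ) (n : ℕ) (γ : ℝ) : ℝ≥0∞ :=
  algError r s μ₁ μ₂ p δ (hyperbolicCross r n γ) (truncation r n γ)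

/-- `x` lies between `c₁ y` and `c₂ y`; with constants `c₁, c₂ > 0` independent of the parameters
this is `x ≍ y`. -/
def Between (c₁ c₂ x y : ℝ) : Prop := c₁ * y ≤ x ∧ x ≤ c₂ * y

end NumDiff

end

/-! Upper bound. Rows k are mutually orthogonal because the φ_k are orthonormal in t, and inside a
row the triangle inequality with ‖φ_j^{(r)}‖ ≲ j^{2r-1/2} is used. With m = max(1, n), the error of
truncation to the cross splits into the coefficients outside it and the noise inside it. Cutting row
k at m/k^γ, Hölder's inequality in j bounds the first part by m^{-β} k^{γβ-μ₁} times the ℓ_s norm of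
the row. These bounds are square summable over k when γβ < μ₁ + 1/s - 1/2, which gives
`exists_norm_tail_le`. The noise is at most of order δ m^{2r+1/2-1/p} = δ m^{a-β} by
`exists_norm_noise_le`. The two parts balance at m ≍ δ^{-1/a}, with common value δ^{β/a}.

Lower bound. It needs no noise. Any Ω with N points misses at least half of the indices (0, j), M ≤
j < 2M, once M ≥ 2N. The sum of the missed φ_0 φ_j, scaled into the class, and its negative have the
same zero data, so the error is at least the norm of its derivative. All φ_j^{(r)}(1) are positive
and of order at least j^{2r+1/2}. The Nikolskii inequality `sq_eval_one_le_polyInner` turns this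
large value at 1 into an L₂ norm of order at least M^{2r+1/2}, the same order as the triangle
inequality allows. Hence `exists_le_minRadius` gives N^{-β}.

Counting. Row k of the cross has at most n/max(1,k)^γ points. The total is of order n for γ > 1 and
n ln n for γ = 1, and this logarithm is the gap between the bounds in part (b). -/

namespace NumDiff

/-! ### Legendre polynomials: orthonormality, end-point values, norms of derivatives. -/

section LegendrePolynomials

open Polynomial

/-- The inner product `∫_{-1}^1 u v` of two real polynomials. -/
noncomputable def polyInner (u v : ℝ[X]) : ℝ := ∫ x in (-1 : ℝ)..1, u.eval x * v.eval x

theorem intervalIntegrable_eval_mul_eval (u v : ℝ[X]) :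
    IntervalIntegrable (fun x => u.eval x * v.eval x) volume (-1) 1 :=
  Continuous.intervalIntegrable (by fun_prop) _ _

theorem polyInner_comm (u v : ℝ[X]) : polyInner u v = polyInner v u := by
  simp only [polyInner, mul_comm]

theorem polyInner_add_left (u v w : ℝ[X]) :
    polyInner (u + v) w = polyInner u w + polyInner v w := by
  simp only [polyInner, eval_add, add_mul]
  exact intervalIntegral.integral_add (intervalIntegrable_eval_mul_eval _ _)
    (intervalIntegrable_eval_mul_eval _ _)

theorem polyInner_C_mul_left (c : ℝ) (u w : ℝ[X]) :
    polyInner (C c * u) w = c * polyInner u w := by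
  simp only [polyInner, eval_mul, eval_C, mul_assoc]
  exact intervalIntegral.integral_const_mul _ _

theorem polyInner_add_right (u v w : ℝ[X]) :
    polyInner w (u + v) = polyInner w u + polyInner w v := by
  rw [polyInner_comm, polyInner_add_left, polyInner_comm u, polyInner_comm v]

theorem polyInner_C_mul_right (c : ℝ) (u w : ℝ[X]) :
    polyInner w (C c * u) = c * polyInner w u := by
  rw [polyInner_comm, polyInner_C_mul_left, polyInner_comm]

theorem polyInner_zero_right (u : ℝ[X]) : polyInner u 0 = 0 := by
  simp [polyInner]

theorem polyInner_self_nonneg (u : ℝ[X]) : 0 ≤ polyInner u u :=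
  intervalIntegral.integral_nonneg (by norm_num) fun x _ => mul_self_nonneg _

theorem polyInner_derivative_left (u v : ℝ[X]) :
    polyInner (derivative u) v =
      u.eval 1 * v.eval 1 - u.eval (-1) * v.eval (-1) - polyInner u (derivative v) := by
  have h : ∫ x in (-1 : ℝ)..1, (derivative (u * v)).eval x =
      (u * v).eval 1 - (u * v).eval (-1) :=
    intervalIntegral.integral_eq_sub_of_hasDerivAt (fun x _ => (u * v).hasDerivAt x)
      (Continuous.intervalIntegrable (by fun_prop) _ _)
  simp only [derivative_mul, eval_add, eval_mul] at h
  rw [intervalIntegral.integral_add (intervalIntegrable_eval_mul_eval _ _)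
    (intervalIntegrable_eval_mul_eval _ _)] at h
  simp only [polyInner]
  linarith

theorem X_sq_sub_one_pow {a : ℝ} (ha : a ^ 2 = 1) (n : ℕ) :
    ((X : ℝ[X]) ^ 2 - 1) ^ n = (X - C a) ^ n * (X + C a) ^ n := by
  rw [← mul_pow]
  congr 1
  have : (C a : ℝ[X]) * C a = 1 := by rw [← C_mul, ← pow_two, ha, C_1]
  linear_combination this

/-- In Leibniz' formula for (X - a)^n (X + a)^n only the term that differentiates X - a exactly n
times survives at a. Working with a² = 1 treats both end points at once. -/
theorem eval_iterate_derivative_X_sq_sub_one_pow {a : ℝ} (ha : a ^ 2 = 1) (n i : ℕ) :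
    (derivative^[n + i] (((X : ℝ[X]) ^ 2 - 1) ^ n)).eval a =
      ((n + i).choose i : ℝ) * n.factorial * n.descFactorial i * (2 * a) ^ (n - i) := by
  rw [X_sq_sub_one_pow ha, iterate_derivative_mul, eval_finsetSum,
    Finset.sum_eq_single_of_mem i (Finset.mem_range.2 (by omega))]
  · simp [iterate_derivative_X_sub_pow, iterate_derivative_X_add_pow, Nat.descFactorial_self]
    ring
  · intro k hk hki
    rw [Finset.mem_range] at hk
    rw [iterate_derivative_X_sub_pow]
    rcases lt_or_gt_of_ne hki with h | h
    · rw [Nat.descFactorial_of_lt (by omega)]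
      simp
    · have : n - (n + i - k) ≠ 0 := by omega
      simp [this]

theorem eval_iterate_derivative_X_sq_sub_one_pow_of_lt {a : ℝ} (ha : a ^ 2 = 1) {m n : ℕ}
    (h : m < n) : (derivative^[m] (((X : ℝ[X]) ^ 2 - 1) ^ n)).eval a = 0 := by
  obtain ⟨w, hw⟩ := pow_sub_dvd_iterate_derivative_pow ((X : ℝ[X]) ^ 2 - 1) n m
  have : n - m ≠ 0 := by omega
  rw [hw]
  simp [ha, this]

/-- Integration by parts: the boundary terms vanish because (X² - 1)^n has zeros of order n at ±1,
while each step lowers the degree of q. -/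
theorem polyInner_iterate_derivative_eq_zero {m n : ℕ} (h : m ≤ n) {q : ℝ[X]}
    (hq : q.degree < m) : polyInner (derivative^[m] ((X ^ 2 - 1) ^ n)) q = 0 := by
  induction m generalizing q with
  | zero =>
    have : q = 0 := by
      rw [← degree_eq_bot]
      exact Nat.WithBot.lt_zero_iff.1 (by simpa using hq)
    rw [this, polyInner_zero_right]
  | succ m ih =>
    rw [Function.iterate_succ_apply', polyInner_derivative_left,
      eval_iterate_derivative_X_sq_sub_one_pow_of_lt (by norm_num) (by omega),
      eval_iterate_derivative_X_sq_sub_one_pow_of_lt (by norm_num) (by omega),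
      ih (by omega)]
    · simp
    · by_cases h0 : q = 0
      · simp [h0, bot_lt_iff_ne_bot]
      · have := degree_derivative_lt h0
        rw [degree_eq_natDegree h0] at this hq
        refine this.trans_le ?_
        norm_cast at hq ⊢
        omega

theorem eval_iterate_derivative_legendre {a : ℝ} (ha : a ^ 2 = 1) (n i : ℕ) :
    (derivative^[i] (legendre n)).eval a =
      Real.sqrt (n + 1 / 2) * ((2 : ℝ) ^ n)⁻¹ * ((n + i).choose i * n.descFactorial i *
        (2 * a) ^ (n - i)) := by
  rw [legendre, iterate_derivative_C_mul, ← Function.iterate_add_apply, add_comm i n, eval_C_mul,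
    eval_iterate_derivative_X_sq_sub_one_pow ha]
  have := n.factorial_ne_zero
  field_simp

theorem sq_eval_legendre {a : ℝ} (ha : a ^ 2 = 1) (n : ℕ) :
    (legendre n).eval a ^ 2 = n + 1 / 2 := by
  have := eval_iterate_derivative_legendre ha n 0
  simp only [Function.iterate_zero_apply] at this
  rw [this]
  have h : (a ^ n) ^ 2 = 1 := by rw [← pow_mul, mul_comm, pow_mul, ha, one_pow]
  simp only [mul_pow, Real.sq_sqrt (by positivity : (0 : ℝ) ≤ n + 1 / 2)]
  simp [h]

theorem eval_one_legendre (n : ℕ) : (legendre n).eval 1 = Real.sqrt (n + 1 / 2) := by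
  simpa using eval_iterate_derivative_legendre (one_pow 2) n 0

theorem natDegree_legendre_le (n : ℕ) : (legendre n).natDegree ≤ n := by
  refine (natDegree_C_mul_le _ _).trans ((natDegree_iterate_derivative _ _).trans ?_)
  have h1 : ((X : ℝ[X]) ^ 2 - 1).natDegree ≤ 2 := by compute_degree
  have : (((X : ℝ[X]) ^ 2 - 1) ^ n).natDegree ≤ n * 2 := natDegree_pow_le_of_le n h1
  omega

theorem polyInner_legendre_of_degree_lt {n : ℕ} {q : ℝ[X]} (hq : q.degree < n) :
    polyInner (legendre n) q = 0 := by
  rw [legendre, polyInner_C_mul_left, polyInner_iterate_derivative_eq_zero le_rfl hq, mul_zero]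

theorem degree_lt_of_natDegree_le_of_coeff {n : ℕ} {q : ℝ[X]} (h : q.natDegree ≤ n)
    (hc : q.coeff n = 0) : q.degree < n := by
  rw [degree_lt_iff_coeff_zero]
  intro m hm
  rcases hm.eq_or_lt with rfl | hm
  · exact hc
  · exact coeff_eq_zero_of_natDegree_lt (by omega)

/-- Put P = φ_n and I = ⟨P, P⟩. Since xP' - nP has degree below n, ⟨xP', P⟩ = nI. Integrating (xP)'P
by parts gives I + 2nI = P(1)² + P(-1)² = 2n + 1. -/
theorem polyInner_legendre_self (n : ℕ) : polyInner (legendre n) (legendre n) = 1 := by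
  have h1 := polyInner_derivative_left (X * legendre n) (legendre n)
  have hlow : (X * derivative (legendre n) + C (-(n : ℝ)) * legendre n).degree < (n : WithBot ℕ) := by
    refine degree_lt_of_natDegree_le_of_coeff ?_ ?_
    · refine natDegree_add_le_of_degree_le ?_
        ((natDegree_C_mul_le _ _).trans (natDegree_legendre_le n))
      rcases n with _ | n
      · have : derivative (legendre 0) = 0 :=
          derivative_of_natDegree_zero (Nat.le_zero.1 (natDegree_legendre_le 0))
        simp [this]
      · have h2 := natDegree_derivative_le (legendre (n + 1))
        have h3 := natDegree_legendre_le (n + 1)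
        have h4 := natDegree_mul_le (p := (X : ℝ[X])) (q := derivative (legendre (n + 1)))
        rw [natDegree_X] at h4
        omega
    · rcases n with _ | n
      · simp
      · rw [coeff_add, coeff_X_mul, coeff_derivative, coeff_C_mul]
        push_cast
        ring
  have h2 := polyInner_legendre_of_degree_lt hlow
  rw [polyInner_add_right, polyInner_C_mul_right] at h2
  have h3 : polyInner (X * legendre n) (derivative (legendre n)) =
      polyInner (legendre n) (X * derivative (legendre n)) := by
    simp only [polyInner, eval_mul, eval_X]
    congr 1
    ext x
    ring
  rw [derivative_mul, derivative_X, one_mul, polyInner_add_left,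
    polyInner_comm (X * derivative (legendre n)), h3] at h1
  simp only [eval_mul, eval_X] at h1
  have e1 := sq_eval_legendre (a := 1) (by norm_num) n
  have e2 := sq_eval_legendre (a := -1) (by norm_num) n
  have : (2 * (n : ℝ) + 1) * polyInner (legendre n) (legendre n) = 2 * n + 1 := by
    linear_combination h1 - 2 * h2 + e1 + e2
  have hn : (2 * (n : ℝ) + 1) ≠ 0 := by positivity
  exact mul_left_cancel₀ hn (by rw [this, mul_one])

theorem coeff_legendre_self_ne_zero (n : ℕ) : (legendre n).coeff n ≠ 0 := by
  intro h
  have := polyInner_legendre_of_degree_lt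
    (degree_lt_of_natDegree_le_of_coeff (natDegree_legendre_le n) h)
  rw [polyInner_legendre_self] at this
  exact one_ne_zero this

theorem degree_legendre_lt {m n : ℕ} (h : m < n) : (legendre m).degree < n :=
  (degree_le_of_natDegree_le (natDegree_legendre_le m)).trans_lt (by exact_mod_cast h)

theorem polyInner_legendre (m n : ℕ) :
    polyInner (legendre m) (legendre n) = if m = n then 1 else 0 := by
  split_ifs with h
  · rw [h, polyInner_legendre_self]
  · rcases lt_or_gt_of_ne h with h | h
    · rw [polyInner_comm, polyInner_legendre_of_degree_lt (degree_legendre_lt h)]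
    · rw [polyInner_legendre_of_degree_lt (degree_legendre_lt h)]

/-- A Nikolskii inequality: the value at `1` is controlled by the `L₂` norm. -/
theorem sq_eval_one_le_polyInner (n : ℕ) {P : ℝ[X]} (hP : P.degree < n) :
    P.eval 1 ^ 2 ≤ (n : ℝ) ^ 2 / 2 * polyInner P P := by
  induction n generalizing P with
  | zero =>
    have : P = 0 := by
      rw [← degree_eq_bot]
      exact Nat.WithBot.lt_zero_iff.1 (by simpa using hP)
    simp [this]
  | succ n ih =>
    -- Splitting off the component along φ_n leaves a polynomial of lower degree. The constant is
    -- n²/2 = ∑_{k<n} φ_k(1)², so the induction step rests on n²/2 + (n + 1/2) = (n + 1)²/2.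
    set c := P.coeff n / (legendre n).coeff n with hc
    set S := P + C (-c) * legendre n with hS
    have hSd : S.degree < n := by
      refine degree_lt_of_natDegree_le_of_coeff ?_ ?_
      · refine natDegree_add_le_of_degree_le ?_
          ((natDegree_C_mul_le _ _).trans (natDegree_legendre_le n))
        exact natDegree_le_of_degree_le (Order.le_of_lt_succ (by exact_mod_cast hP))
      · rw [hS, coeff_add, coeff_C_mul, hc]
        field_simp [coeff_legendre_self_ne_zero n]
        ring
    have hPS : P = S + C c * legendre n := by rw [hS, C_neg]; ring
    have h0 := polyInner_legendre_of_degree_lt hSd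
    have hin : polyInner P P = polyInner S S + c ^ 2 := by
      rw [hPS]
      simp only [polyInner_add_left, polyInner_add_right, polyInner_C_mul_left,
        polyInner_C_mul_right, polyInner_comm S (legendre n), h0, polyInner_legendre_self]
      ring
    have hev : P.eval 1 = S.eval 1 + c * Real.sqrt (n + 1 / 2) := by
      rw [hPS, eval_add, eval_C_mul, eval_one_legendre]
    have hsq := Real.sq_sqrt (by positivity : (0 : ℝ) ≤ n + 1 / 2)
    set y := Real.sqrt ((n : ℝ) + 1 / 2)
    have hi := ih hSd
    have hpos := polyInner_self_nonneg S
    rw [hin, hev]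
    push_cast
    set e := S.eval 1
    set A := polyInner S S
    rcases Nat.eq_zero_or_pos n with hn | hn
    · subst hn
      norm_num at hi hsq ⊢
      have : e = 0 := by nlinarith
      rw [this]
      nlinarith [sq_nonneg c]
    · have hn' : (0 : ℝ) < n := by exact_mod_cast hn
      -- Cauchy–Schwarz for two summands with weights `n² / 2` and `n + 1 / 2`
      have hcs : 2 * e * (c * y) * (n ^ 2 / 2) ≤ y ^ 2 * e ^ 2 + (n ^ 2 / 2) ^ 2 * c ^ 2 := by
        nlinarith [sq_nonneg (y * e - n ^ 2 / 2 * c)]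
      have h2 : y ^ 2 * e ^ 2 ≤ y ^ 2 * (n ^ 2 / 2 * A) := by gcongr
      have h3 : 2 * e * (c * y) ≤ y ^ 2 * A + n ^ 2 / 2 * c ^ 2 := by
        have : 2 * e * (c * y) * (n ^ 2 / 2 : ℝ) ≤
            (y ^ 2 * A + n ^ 2 / 2 * c ^ 2) * (n ^ 2 / 2 : ℝ) := by linarith
        exact le_of_mul_le_mul_right this (by positivity)
      have h4 : (c * y) ^ 2 = c ^ 2 * (n + 1 / 2) := by rw [mul_pow, hsq]
      rw [hsq] at h3
      nlinarith

/-- At the end points the derivative of order `i` of `φ_n` is of the order `n^{2i + 1/2}`. -/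
theorem abs_eval_iterate_derivative_legendre_le {a : ℝ} (ha : a ^ 2 = 1) {n : ℕ} (hn : 1 ≤ n)
    (i : ℕ) : |(derivative^[i] (legendre n)).eval a| ≤
      Real.sqrt (n + 1 / 2) * ((1 + i : ℝ) ^ i * (n : ℝ) ^ (2 * i)) := by
  have habs : |a| = 1 := by rwa [← sq_eq_sq₀ (abs_nonneg a) zero_le_one, sq_abs, one_pow]
  rw [eval_iterate_derivative_legendre ha]
  simp only [abs_mul, abs_pow, habs, abs_two, mul_one, abs_of_nonneg (Real.sqrt_nonneg _), abs_inv,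
    Nat.abs_cast]
  rw [mul_assoc]
  refine mul_le_mul_of_nonneg_left ?_ (Real.sqrt_nonneg _)
  have h1 : ((n + i).choose i : ℝ) ≤ ((1 + i : ℝ) * n) ^ i := by
    have : n + i ≤ (1 + i) * n := by nlinarith
    exact_mod_cast (Nat.choose_le_pow (n + i) i).trans (Nat.pow_le_pow_left this i)
  have h2 : (n.descFactorial i : ℝ) ≤ (n : ℝ) ^ i := by exact_mod_cast Nat.descFactorial_le_pow n i
  have h3 : (2 : ℝ) ^ (n - i) ≤ 2 ^ n := pow_le_pow_right₀ one_le_two (by omega)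
  calc ((2 : ℝ) ^ n)⁻¹ * ((n + i).choose i * n.descFactorial i * 2 ^ (n - i))
      ≤ ((2 : ℝ) ^ n)⁻¹ * (((1 + i : ℝ) * n) ^ i * (n : ℝ) ^ i * 2 ^ n) := by gcongr
    _ = (1 + i : ℝ) ^ i * (n : ℝ) ^ (2 * i) := by
      rw [mul_pow]
      field_simp
      ring

/-- Parts are integrated r times until φ_n meets its own derivative of order 2r, which is orthogonal
to it by degree. Only boundary terms with derivative orders i + j = 2r - 1 remain, each of size n ·
n^{2i+2j} = n^{4r-1}. -/
theorem exists_polyInner_iterate_derivative_legendre_le (r : ℕ) (hr : 1 ≤ r) :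
    ∃ K : ℝ, 0 < K ∧ ∀ n : ℕ, 1 ≤ n →
      polyInner (derivative^[r] (legendre n)) (derivative^[r] (legendre n)) ≤
        K * (n : ℝ) ^ (4 * r - 1) := by
  set B : ℝ := ((1 + 2 * r : ℕ) : ℝ) ^ (4 * r) with hB
  have hB0 : 0 < B := by positivity
  refine ⟨r * (2 * (3 / 2 * B)), by positivity, fun n hn => ?_⟩
  have hn' : (1 : ℝ) ≤ n := by exact_mod_cast hn
  have hb : ∀ a : ℝ, a ^ 2 = 1 → ∀ i j : ℕ, i + j = 2 * r - 1 →
      |(derivative^[i] (legendre n)).eval a * (derivative^[j] (legendre n)).eval a| ≤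
        3 / 2 * B * (n : ℝ) ^ (4 * r - 1) := by
    intro a ha i j hij
    rw [abs_mul]
    have hi := abs_eval_iterate_derivative_legendre_le ha hn i
    have hj := abs_eval_iterate_derivative_legendre_le ha hn j
    have hpow : ∀ i : ℕ, i ≤ 2 * r → (1 + i : ℝ) ^ i ≤ ((1 + 2 * r : ℕ) : ℝ) ^ (2 * r) := by
      intro i hi
      have : (1 + i) ^ i ≤ (1 + 2 * r) ^ (2 * r) :=
        (Nat.pow_le_pow_left (by omega) i).trans (Nat.pow_le_pow_right (by omega) hi)
      exact_mod_cast this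
    calc _ ≤ (Real.sqrt (n + 1 / 2) * ((1 + i : ℝ) ^ i * (n : ℝ) ^ (2 * i))) *
          (Real.sqrt (n + 1 / 2) * ((1 + j : ℝ) ^ j * (n : ℝ) ^ (2 * j))) := by gcongr
      _ = (Real.sqrt (n + 1 / 2)) ^ 2 * ((1 + i : ℝ) ^ i * (1 + j : ℝ) ^ j) *
          ((n : ℝ) ^ (2 * i) * (n : ℝ) ^ (2 * j)) := by ring
      _ ≤ (3 / 2 * n) * (((1 + 2 * r : ℕ) : ℝ) ^ (2 * r) * ((1 + 2 * r : ℕ) : ℝ) ^ (2 * r)) *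
          ((n : ℝ) ^ (2 * i) * (n : ℝ) ^ (2 * j)) := by
        rw [Real.sq_sqrt (by positivity)]
        have h1 := hpow i (by omega)
        have h2 := hpow j (by omega)
        have : (n : ℝ) + 1 / 2 ≤ 3 / 2 * n := by linarith
        gcongr
      _ = 3 / 2 * B * (n : ℝ) ^ (4 * r - 1) := by
        rw [hB, ← pow_add, ← pow_add,
          (by omega : 2 * r + 2 * r = 4 * r), (by omega : 4 * r - 1 = 2 * i + 2 * j + 1), pow_succ]
        ring
  have key : ∀ m ≤ r, |polyInner (derivative^[m] (legendre n))
      (derivative^[2 * r - m] (legendre n))| ≤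
        m * (2 * (3 / 2 * B)) * (n : ℝ) ^ (4 * r - 1) := by
    intro m
    induction m with
    | zero =>
      intro _
      have : (derivative^[2 * r] (legendre n)).degree < n := by
        have h1 := natDegree_iterate_derivative (legendre n) (2 * r)
        have h2 := natDegree_legendre_le n
        refine degree_le_natDegree.trans_lt ?_
        norm_cast
        omega
      simp [polyInner_legendre_of_degree_lt this]
    | succ m ih =>
      intro hm
      have ih := ih (by omega)
      have e : derivative (derivative^[2 * r - (m + 1)] (legendre n)) =
          derivative^[2 * r - m] (legendre n) := by
        rw [← Function.iterate_succ_apply' derivative,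
          (by omega : (2 * r - (m + 1)).succ = 2 * r - m)]
      rw [Function.iterate_succ_apply', polyInner_derivative_left, e]
      have b1 := hb 1 (by norm_num) m (2 * r - (m + 1)) (by omega)
      have b2 := hb (-1) (by norm_num) m (2 * r - (m + 1)) (by omega)
      refine (abs_sub _ _).trans ?_
      refine (add_le_add_left (abs_sub _ _) _).trans ?_
      push_cast
      linarith
  have := key r le_rfl
  rw [(by omega : 2 * r - r = r)] at this
  exact (le_abs_self _).trans this

/-- Positivity at 1 is what matters: sums of such derivatives cannot cancel there. The falling
factorial and the binomial coefficient contribute (n/2)^r each, the latter divided by r!, and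
2^{n-r}/2^n gives the last 2^r. -/
theorem le_eval_one_iterate_derivative_legendre (r n : ℕ) (hn : 2 * r ≤ n) :
    ((2 : ℝ) ^ r * 2 ^ r * r.factorial * 2 ^ r)⁻¹ * (n : ℝ) ^ (2 * r) * Real.sqrt n ≤
      (derivative^[r] (legendre n)).eval 1 := by
  rw [eval_iterate_derivative_legendre (one_pow 2)]
  have h1 : ((n : ℝ) / 2) ^ r ≤ n.descFactorial r := by
    have h := Nat.pow_sub_le_descFactorial n r
    have h' : ((n + 1 - r : ℕ) : ℝ) ^ r ≤ n.descFactorial r := by exact_mod_cast h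
    refine (pow_le_pow_left₀ (by positivity) ?_ r).trans h'
    rw [Nat.cast_sub (by omega)]
    push_cast
    have : (2 * r : ℝ) ≤ n := by exact_mod_cast hn
    linarith
  have h2 : ((n : ℝ) / 2) ^ r ≤ r.factorial * (n + r).choose r := by
    have h : n.descFactorial r ≤ r.factorial * (n + r).choose r := by
      rw [← Nat.descFactorial_eq_factorial_mul_choose]
      exact Nat.descFactorial_le r (by omega)
    exact h1.trans (by exact_mod_cast h)
  have h3 : (2 : ℝ) ^ n = 2 ^ (n - r) * 2 ^ r := by rw [← pow_add]; congr 1; omega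
  have h4 : Real.sqrt n ≤ Real.sqrt (n + 1 / 2) := Real.sqrt_le_sqrt (by linarith)
  have hf : (0 : ℝ) < r.factorial := by exact_mod_cast r.factorial_pos
  have h5 : ((n : ℝ) / 2) ^ r / r.factorial ≤ (n + r).choose r := by
    rw [div_le_iff₀ hf]; linarith
  calc _ = Real.sqrt n * ((2 : ℝ) ^ n)⁻¹ * ((((n : ℝ) / 2) ^ r / r.factorial) * ((n : ℝ) / 2) ^ r *
        (2 * 1) ^ (n - r)) := by
        rw [h3, div_pow, pow_mul', pow_two]
        field_simp
    _ ≤ _ := by gcongr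

end LegendrePolynomials

/-! ### Tensor products in L₂(Q) and orthogonality of rows. -/

section Tensors

open Polynomial

theorem inner_tensor (u v u' v' : ℝ[X]) :
    inner ℝ (tensor u v) (tensor u' v') = polyInner u u' * polyInner v v' := by
  have h1 : inner ℝ (tensor u v) (tensor u' v') =
      ∫ x : ℝ × ℝ in Q, (u.eval x.1 * u'.eval x.1) * (v.eval x.2 * v'.eval x.2) := by
    rw [L2.inner_def]
    refine integral_congr_ae ?_
    filter_upwards [(memLp_tensor u v).coeFn_toLp, (memLp_tensor u' v').coeFn_toLp] with x h h'
    rw [tensor, tensor, h, h']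
    simp only [RCLike.inner_apply, conj_trivial]
    ring
  rw [h1, Q, Measure.volume_eq_prod, ← Measure.prod_restrict,
    integral_prod_mul (fun t => u.eval t * u'.eval t) (fun t => v.eval t * v'.eval t)]
  simp only [polyInner]
  rw [intervalIntegral.integral_of_le (by norm_num), intervalIntegral.integral_of_le (by norm_num),
    integral_Icc_eq_integral_Ioc, integral_Icc_eq_integral_Ioc]

theorem tensor_add_right (u v w : ℝ[X]) : tensor u (v + w) = tensor u v + tensor u w := by
  rw [tensor, tensor, tensor, ← MemLp.toLp_add]
  congr 1
  ext x
  simp [mul_add]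

theorem tensor_zero_right (u : ℝ[X]) : tensor u 0 = 0 := by
  have := tensor_add_right u 0 0
  simpa using this

theorem tensor_sum_right {ι : Type*} (u : ℝ[X]) (T : Finset ι) (v : ι → ℝ[X]) :
    tensor u (∑ j ∈ T, v j) = ∑ j ∈ T, tensor u (v j) := by
  classical
  induction T using Finset.induction_on with
  | empty => simp [tensor_zero_right]
  | insert a T ha ih => rw [Finset.sum_insert ha, Finset.sum_insert ha, tensor_add_right, ih]

theorem norm_sq_tensor_legendre_left (k : ℕ) (v : ℝ[X]) :
    ‖tensor (legendre k) v‖ ^ 2 = polyInner v v := by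
  rw [← real_inner_self_eq_norm_sq, inner_tensor, polyInner_legendre_self, one_mul]

theorem inner_tensor_legendre_of_ne {k l : ℕ} (h : k ≠ l) (v w : ℝ[X]) :
    inner ℝ (tensor (legendre k) v) (tensor (legendre l) w) = 0 := by
  rw [inner_tensor, polyInner_legendre, if_neg h, zero_mul]

theorem coef_tensor_legendre (q q' : ℕ × ℕ) :
    coef (tensor (legendre q'.1) (legendre q'.2)) q = if q' = q then 1 else 0 := by
  rw [coef, inner_tensor, polyInner_legendre, polyInner_legendre]
  by_cases h1 : q'.1 = q.1 <;> by_cases h2 : q'.2 = q.2 <;> simp [h1, h2, Prod.ext_iff]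

theorem coef_neg (f : L2Q) (q : ℕ × ℕ) : coef (-f) q = -coef f q := inner_neg_left _ _

theorem coef_smul (c : ℝ) (f : L2Q) (q : ℕ × ℕ) : coef (c • f) q = c * coef f q :=
  real_inner_smul_left _ _ _

theorem coef_sum {ι : Type*} (T : Finset ι) (f : ι → L2Q) (q : ℕ × ℕ) :
    coef (∑ i ∈ T, f i) q = ∑ i ∈ T, coef (f i) q := sum_inner _ _ _

theorem norm_sq_sum_of_pairwise_inner_eq_zero {E ι : Type*} [NormedAddCommGroup E]
    [InnerProductSpace ℝ E] (T : Finset ι) (v : ι → E)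
    (h : ∀ i ∈ T, ∀ j ∈ T, i ≠ j → inner ℝ (v i) (v j) = 0) :
    ‖∑ i ∈ T, v i‖ ^ 2 = ∑ i ∈ T, ‖v i‖ ^ 2 := by
  rw [← real_inner_self_eq_norm_sq, sum_inner]
  refine Finset.sum_congr rfl fun i hi => ?_
  rw [inner_sum, Finset.sum_eq_single_of_mem i hi fun j hj hji => h i hi j hj hji.symm,
    real_inner_self_eq_norm_sq]

theorem exists_norm_derivTensor_le (r : ℕ) (hr : 1 ≤ r) :
    ∃ K : ℝ, 0 < K ∧ ∀ q : ℕ × ℕ, 1 ≤ q.2 →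
      ‖derivTensor r q‖ ≤ K * (q.2 : ℝ) ^ (2 * (r : ℝ) - 1 / 2) := by
  obtain ⟨K, hK, h⟩ := exists_polyInner_iterate_derivative_legendre_le r hr
  refine ⟨Real.sqrt K, Real.sqrt_pos.2 hK, fun q hq => ?_⟩
  refine abs_le_of_sq_le_sq' ?_ (by positivity) |>.2
  rw [derivTensor, norm_sq_tensor_legendre_left, mul_pow, Real.sq_sqrt hK.le]
  refine (h q.2 hq).trans (le_of_eq ?_)
  congr 1
  rw [← Real.rpow_natCast, ← Real.rpow_natCast, ← Real.rpow_mul (by positivity)]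
  congr 1
  rw [Nat.cast_sub (by omega)]
  push_cast
  ring

/-- The contribution of the row `k` in the estimate of `∑ c_{k,j} φ_k φ_j^{(r)}`. -/
noncomputable def rowSum (r : ℕ) (t : Finset (ℕ × ℕ)) (c : ℕ × ℕ → ℝ) (k : ℕ) : ℝ :=
  ∑ q ∈ t with q.1 = k, |c q| * (q.2 : ℝ) ^ (2 * (r : ℝ) - 1 / 2)

theorem rowSum_nonneg (r : ℕ) (t : Finset (ℕ × ℕ)) (c : ℕ × ℕ → ℝ) (k : ℕ) :
    0 ≤ rowSum r t c k := Finset.sum_nonneg fun q _ => by positivity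

/-- Distinct k give orthogonal rows. Inside a row the φ_j^{(r)} are not orthogonal, and the triangle
inequality is used. -/
theorem exists_norm_sq_sum_derivTensor_le (r : ℕ) (hr : 1 ≤ r) :
    ∃ K : ℝ, 0 < K ∧ ∀ (t : Finset (ℕ × ℕ)) (c : ℕ × ℕ → ℝ), (∀ q ∈ t, 1 ≤ q.2) →
      ‖∑ q ∈ t, c q • derivTensor r q‖ ^ 2 ≤
        K * ∑ k ∈ t.image Prod.fst, rowSum r t c k ^ 2 := by
  obtain ⟨K, hK, h⟩ := exists_norm_derivTensor_le r hr
  refine ⟨K ^ 2, by positivity, fun t c ht => ?_⟩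
  have hfib := Finset.sum_fiberwise_of_maps_to (s := t) (t := t.image Prod.fst) (g := Prod.fst)
    (fun q hq => Finset.mem_image_of_mem _ hq) (fun q => c q • derivTensor r q)
  rw [← hfib, norm_sq_sum_of_pairwise_inner_eq_zero, Finset.mul_sum]
  · refine Finset.sum_le_sum fun k _ => ?_
    rw [← mul_pow]
    refine pow_le_pow_left₀ (norm_nonneg _) ?_ 2
    rw [rowSum, Finset.mul_sum]
    refine norm_sum_le_of_le _ fun q hq => ?_
    rw [norm_smul, Real.norm_eq_abs]
    have := h q (ht q (Finset.mem_filter.1 hq).1)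
    calc |c q| * ‖derivTensor r q‖ ≤ |c q| * (K * (q.2 : ℝ) ^ (2 * (r : ℝ) - 1 / 2)) := by gcongr
      _ = _ := by ring
  · intro k _ l _ hkl
    rw [sum_inner]
    refine Finset.sum_eq_zero fun q hq => ?_
    rw [inner_sum]
    refine Finset.sum_eq_zero fun q' hq' => ?_
    rw [inner_smul_left, inner_smul_right, derivTensor, derivTensor,
      inner_tensor_legendre_of_ne, mul_zero, mul_zero]
    rw [(Finset.mem_filter.1 hq).2, (Finset.mem_filter.1 hq').2]
    exact hkl

end Tensors

/-! ### Truncation and noise estimates, row by row and then summed over rows. -/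

section RowEstimates

/-- A discrete form of integrating x^{-θ}, ready to telescope. The factor 2^θ pays for j + 1 ≤ 2j.
-/
theorem rpow_neg_le_mul_sub {θ : ℝ} (hθ : 1 < θ) {j : ℕ} (hj : 1 ≤ j) :
    (j : ℝ) ^ (-θ) ≤
      2 ^ θ / (θ - 1) * ((j : ℝ) ^ (1 - θ) - ((j + 1 : ℕ) : ℝ) ^ (1 - θ)) := by
  have hj0 : (1 : ℝ) ≤ j := by exact_mod_cast hj
  set y : ℝ := ((j + 1 : ℕ) : ℝ) with hy
  have hyj : y = j + 1 := by rw [hy]; push_cast; ring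
  have hy0 : 0 < y := by positivity
  have h1 : 1 + (θ - 1) / y ≤ ((j : ℝ) / y) ^ (1 - θ) := by
    rw [Real.rpow_def_of_pos (by positivity)]
    have hl := Real.log_le_sub_one_of_pos (by positivity : 0 < (j : ℝ) / y)
    have he := Real.add_one_le_exp (Real.log ((j : ℝ) / y) * (1 - θ))
    have hq : (j : ℝ) / y - 1 = -(1 / y) := by rw [hyj]; field_simp; ring
    rw [hq] at hl
    have : (θ - 1) / y = (1 / y) * (θ - 1) := by ring
    rw [this]
    nlinarith
  have h2 : (θ - 1) * y ^ (-θ) ≤ (j : ℝ) ^ (1 - θ) - y ^ (1 - θ) := by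
    rw [Real.div_rpow (by positivity) hy0.le, le_div_iff₀ (by positivity)] at h1
    have : y ^ (-θ) = y ^ (1 - θ) / y := by
      rw [show -θ = 1 - θ - 1 by ring, Real.rpow_sub_one hy0.ne']
    rw [this]
    have e : (1 + (θ - 1) / y) * y ^ (1 - θ) = y ^ (1 - θ) + (θ - 1) * (y ^ (1 - θ) / y) := by ring
    linarith
  have h3 : (j : ℝ) ^ (-θ) ≤ 2 ^ θ * y ^ (-θ) := by
    have h4 : (2 * (j : ℝ)) ^ (-θ) ≤ y ^ (-θ) :=
      Real.rpow_le_rpow_of_nonpos hy0 (by linarith) (by linarith)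
    rw [Real.mul_rpow (by norm_num) (by positivity), Real.rpow_neg (by norm_num)] at h4
    have := mul_le_mul_of_nonneg_left h4 (by positivity : (0 : ℝ) ≤ 2 ^ θ)
    rwa [mul_inv_cancel_left₀ (by positivity)] at this
  have hθ' : 0 < θ - 1 := by linarith
  calc (j : ℝ) ^ (-θ) ≤ 2 ^ θ * y ^ (-θ) := h3
    _ = 2 ^ θ / (θ - 1) * ((θ - 1) * y ^ (-θ)) := by field_simp
    _ ≤ _ := by gcongr

theorem sum_rpow_neg_le {θ : ℝ} (hθ : 1 < θ) {m : ℝ} (hm : 0 < m) (F : Finset ℕ)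
    (hF : ∀ j ∈ F, 1 ≤ j ∧ m ≤ j) :
    ∑ j ∈ F, (j : ℝ) ^ (-θ) ≤ 2 ^ θ / (θ - 1) * m ^ (1 - θ) := by
  have hθ' : 0 < θ - 1 := by linarith
  -- The cut-off m may be below 1, as happens in rows with k^γ > M; the summation then starts at 1,
  -- and m ≤ a still holds.
  set a := max 1 ⌈m⌉₊ with ha
  set b := a + F.sup id + 1 with hb
  have hsub : F ⊆ Finset.Ico a b := by
    intro j hj
    have h1 := hF j hj
    have h2 : j ≤ F.sup id := Finset.le_sup (f := id) hj
    rw [Finset.mem_Ico]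
    refine ⟨max_le h1.1 (Nat.ceil_le.2 h1.2), by omega⟩
  have hma : m ≤ a := (Nat.le_ceil m).trans (by exact_mod_cast le_max_right _ _)
  calc ∑ j ∈ F, (j : ℝ) ^ (-θ) ≤ ∑ j ∈ Finset.Ico a b, (j : ℝ) ^ (-θ) :=
        Finset.sum_le_sum_of_subset_of_nonneg hsub fun _ _ _ => by positivity
    _ ≤ ∑ j ∈ Finset.Ico a b,
        2 ^ θ / (θ - 1) * ((j : ℝ) ^ (1 - θ) - ((j + 1 : ℕ) : ℝ) ^ (1 - θ)) :=
        Finset.sum_le_sum fun j hj => rpow_neg_le_mul_sub hθ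
          ((le_max_left _ _).trans (Finset.mem_Ico.1 hj).1)
    _ = 2 ^ θ / (θ - 1) * ((a : ℝ) ^ (1 - θ) - (b : ℝ) ^ (1 - θ)) := by
        rw [← Finset.mul_sum]
        have h := Finset.sum_Ico_sub (fun j : ℕ => (j : ℝ) ^ (1 - θ)) (by omega : a ≤ b)
        rw [← neg_inj, ← Finset.sum_neg_distrib] at h
        simp only [neg_sub] at h
        rw [h]
    _ ≤ 2 ^ θ / (θ - 1) * m ^ (1 - θ) := by
        gcongr
        have h1 : (a : ℝ) ^ (1 - θ) ≤ m ^ (1 - θ) :=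
          Real.rpow_le_rpow_of_nonpos hm hma (by linarith)
        have h2 : (0 : ℝ) ≤ (b : ℝ) ^ (1 - θ) := by positivity
        linarith

theorem summable_max_one_rpow_neg {σ : ℝ} (hσ : 1 < σ) :
    Summable fun k : ℕ => (max 1 (k : ℝ)) ^ (-σ) := by
  rw [← summable_nat_add_iff 1]
  have h := (summable_nat_add_iff 1).2 (Real.summable_nat_rpow.2 (by linarith : -σ < -1))
  refine h.congr fun k => ?_
  rw [max_eq_right]
  push_cast
  linarith [(Nat.cast_nonneg k : (0 : ℝ) ≤ k)]

theorem injOn_snd_of_fst_eq (t : Finset (ℕ × ℕ)) (k : ℕ) :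
    Set.InjOn Prod.snd (↑(t.filter fun q => q.1 = k) : Set (ℕ × ℕ)) := by
  intro q hq q' hq' h
  have h1 := (Finset.mem_filter.1 hq).2
  have h2 := (Finset.mem_filter.1 hq').2
  exact Prod.ext (h1.trans h2.symm) h

theorem card_filter_fst_eq_le {t : Finset (ℕ × ℕ)} {k : ℕ} {J : ℝ} (hJ : 0 ≤ J)
    (ht : ∀ q ∈ t, q.1 = k → 1 ≤ q.2 ∧ (q.2 : ℝ) ≤ J) :
    ((t.filter fun q => q.1 = k).card : ℝ) ≤ J := by
  have : (t.filter fun q => q.1 = k).card ≤ (Finset.Icc 1 ⌊J⌋₊).card := by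
    refine Finset.card_le_card_of_injOn Prod.snd (fun q hq => ?_) (injOn_snd_of_fst_eq t k)
    obtain ⟨hqt, hqk⟩ := Finset.mem_filter.1 hq
    have := ht q hqt hqk
    exact Finset.mem_coe.2 (Finset.mem_Icc.2 ⟨this.1, Nat.le_floor this.2⟩)
  rw [Nat.card_Icc, Nat.add_sub_cancel] at this
  exact (by exact_mod_cast this : _ ≤ (⌊J⌋₊ : ℝ)).trans (Nat.floor_le hJ)

/-- Hölder's inequality with exponents s and s': the class controls j^{μ₂}|c|, and the remaining
power of j is summed over the tail j ≥ m. -/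
theorem exists_rowSum_le_of_tail (r : ℕ) {s μ₂ β : ℝ} (hs : 1 < s) (hβ0 : 0 < β)
    (hβ : β = μ₂ - 2 * (r : ℝ) + 1 / s - 1 / 2) :
    ∃ K : ℝ, 0 < K ∧ ∀ (t : Finset (ℕ × ℕ)) (c : ℕ × ℕ → ℝ) (k : ℕ) (m : ℝ), 0 < m →
      (∀ q ∈ t, q.1 = k → 1 ≤ q.2 ∧ m ≤ q.2) →
      rowSum r t c k ≤ K * m ^ (-β) *
        (∑ q ∈ t with q.1 = k, (q.2 : ℝ) ^ (s * μ₂) * |c q| ^ s) ^ (1 / s) := by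
  set s' := Real.conjExponent s with hs'
  have hconj : s.HolderConjugate s' := Real.HolderConjugate.conjExponent hs
  have hs'0 : 0 < s' := hconj.symm.pos
  have hinv : 1 / s' = 1 - 1 / s := by
    have := hconj.inv_add_inv_eq_one
    simp only [one_div]
    linarith
  -- Chosen so that θ/s' = β + 1/s' = μ₂ - 2r + 1/2, the power left after extracting j^{μ₂}; then
  -- (m^{1-θ})^{1/s'} = m^{-β}.
  set θ := β * s' + 1 with hθ
  have hθ1 : 1 < θ := by rw [hθ]; have := mul_pos hβ0 hs'0; linarith
  set D : ℝ := 2 ^ θ / (θ - 1) with hD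
  have hD0 : 0 < D := div_pos (by positivity) (by linarith)
  refine ⟨D ^ (1 / s'), by positivity, fun t c k m hm ht => ?_⟩
  set T := ({q ∈ t | q.1 = k} : Finset (ℕ × ℕ)) with hT
  have hT' : ∀ q ∈ T, 1 ≤ q.2 ∧ m ≤ q.2 := fun q hq =>
    ht q (Finset.mem_filter.1 hq).1 (Finset.mem_filter.1 hq).2
  have hsplit : rowSum r t c k =
      ∑ q ∈ T, ((q.2 : ℝ) ^ μ₂ * |c q|) * (q.2 : ℝ) ^ (-θ / s') := by
    refine Finset.sum_congr rfl fun q hq => ?_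
    have hq0 : (0 : ℝ) < q.2 := by exact_mod_cast (hT' q hq).1
    have : -θ / s' = 2 * (r : ℝ) - 1 / 2 - μ₂ := by
      have : θ / s' = β + 1 / s' := by rw [hθ]; field_simp
      rw [neg_div, this, hinv, hβ]
      ring
    rw [this, mul_comm (_ ^ μ₂), mul_assoc, ← Real.rpow_add hq0]
    congr 2
    ring
  rw [hsplit]
  refine (Real.inner_le_Lp_mul_Lq_of_nonneg T hconj (fun _ _ => by positivity)
    (fun _ _ => by positivity)).trans ?_
  have h1 : ∑ q ∈ T, ((q.2 : ℝ) ^ μ₂ * |c q|) ^ s =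
      ∑ q ∈ T, (q.2 : ℝ) ^ (s * μ₂) * |c q| ^ s := by
    refine Finset.sum_congr rfl fun q _ => ?_
    rw [Real.mul_rpow (by positivity) (abs_nonneg _), ← Real.rpow_mul (by positivity), mul_comm s]
  have h2 : ∑ q ∈ T, ((q.2 : ℝ) ^ (-θ / s')) ^ s' ≤ D * m ^ (1 - θ) := by
    have : ∑ q ∈ T, ((q.2 : ℝ) ^ (-θ / s')) ^ s' = ∑ j ∈ T.image Prod.snd, (j : ℝ) ^ (-θ) := by
      rw [Finset.sum_image (injOn_snd_of_fst_eq t k)]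
      refine Finset.sum_congr rfl fun q _ => ?_
      rw [← Real.rpow_mul (by positivity), div_mul_cancel₀ _ hs'0.ne']
    rw [this]
    refine sum_rpow_neg_le hθ1 hm _ fun j hj => ?_
    obtain ⟨q, hq, rfl⟩ := Finset.mem_image.1 hj
    exact hT' q hq
  have h3 : (D * m ^ (1 - θ)) ^ (1 / s') = D ^ (1 / s') * m ^ (-β) := by
    rw [Real.mul_rpow hD0.le (by positivity), ← Real.rpow_mul hm.le]
    congr 2
    rw [hθ]
    field_simp
    ring
  rw [h1, mul_comm, ← h3]
  gcongr

/-- The `q`-th term of the weighted `ℓ_s` norm of a double sequence. -/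
noncomputable def seqTerm (s μ₁ μ₂ : ℝ) (c : ℕ × ℕ → ℝ) (q : ℕ × ℕ) : ℝ :=
  (max 1 (q.1 : ℝ)) ^ (s * μ₁) * (max 1 (q.2 : ℝ)) ^ (s * μ₂) * |c q| ^ s

theorem seqTerm_nonneg (s μ₁ μ₂ : ℝ) (c : ℕ × ℕ → ℝ) (q : ℕ × ℕ) :
    0 ≤ seqTerm s μ₁ μ₂ c q := by unfold seqTerm; positivity

/-- Below the threshold τ the first summand suffices, above it the second. This replaces Hölder's
inequality with exponent s/2 and needs no separate case s = 2. -/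
theorem sq_mul_le_add_rpow {s τ w x : ℝ} (hs : 2 ≤ s) (hτ : 0 < τ) (hw : 0 ≤ w) (hx : 0 ≤ x)
    (h : τ ^ (2 - s) * w ≤ 1) : x ^ 2 * w ≤ τ ^ 2 * w + x ^ s := by
  rcases le_or_gt x τ with hxτ | hxτ
  · have : x ^ 2 * w ≤ τ ^ 2 * w := by gcongr
    have : 0 ≤ x ^ s := by positivity
    linarith
  · have hx0 : 0 < x := hτ.trans hxτ
    have h1 : x ^ (2 : ℕ) = x ^ s * x ^ (2 - s) := by
      rw [← Real.rpow_add hx0, ← Real.rpow_natCast]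
      congr 1
      push_cast
      ring
    have h2 : x ^ (2 - s) ≤ τ ^ (2 - s) :=
      Real.rpow_le_rpow_of_nonpos hτ hxτ.le (by linarith)
    have h3 : x ^ 2 * w ≤ x ^ s := by
      rw [h1, mul_assoc]
      have : x ^ (2 - s) * w ≤ 1 := (by gcongr : _ ≤ τ ^ (2 - s) * w).trans h
      exact mul_le_of_le_one_right (by positivity) this
    have : 0 ≤ τ ^ 2 * w := by positivity
    linarith

/-- Row k contributes at most M^{-β} k^{γβ-μ₁} x_k up to a constant, where ∑ x_k^s ≤ 1. The
condition on γ makes the squares of these bounds summable over k. -/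
theorem exists_norm_tail_le_of_sum_le_one (r : ℕ) (hr : 1 ≤ r) {s μ₁ μ₂ β γ : ℝ} (hs : 2 ≤ s)
    (hβ0 : 0 < β) (hβ : β = μ₂ - 2 * (r : ℝ) + 1 / s - 1 / 2) (hγ : γ * β < μ₁ + 1 / s - 1 / 2) :
    ∃ K : ℝ, 0 < K ∧ ∀ (t : Finset (ℕ × ℕ)) (c : ℕ × ℕ → ℝ) (M : ℝ), 0 < M →
      (∀ q ∈ t, 1 ≤ q.2 ∧ M / (max 1 (q.1 : ℝ)) ^ γ ≤ q.2) →
      ∑ q ∈ t, seqTerm s μ₁ μ₂ c q ≤ 1 →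
      ‖∑ q ∈ t, c q • derivTensor r q‖ ≤ K * M ^ (-β) := by
  obtain ⟨K₁, hK₁, h₁⟩ := exists_norm_sq_sum_derivTensor_le r hr
  obtain ⟨K₂, hK₂, h₂⟩ := exists_rowSum_le_of_tail r (s := s) (by linarith) hβ0 hβ
  have hs0 : 0 < s := by linarith
  -- ε is the slack in the condition on γ. With thresholds τ_k = k^{-1/s-η}, the term τ_k² w_k is
  -- k^{-σ} with σ > 1, and τ_k^{2-s} w_k ≤ 1 amounts to (s - 2)η ≤ 2ε, which η = ε/s satisfies.
  set ε := μ₁ - γ * β - 1 / 2 + 1 / s with hε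
  have hε0 : 0 < ε := by rw [hε]; linarith
  set η := ε / s with hη
  have hη0 : 0 < η := div_pos hε0 hs0
  set σ := 1 + 2 * η + 2 * ε with hσ
  have hsum := summable_max_one_rpow_neg (σ := σ) (by linarith)
  set S := ∑' k : ℕ, (max 1 (k : ℝ)) ^ (-σ) with hS
  have hS0 : 0 ≤ S := tsum_nonneg fun k => by positivity
  set w : ℕ → ℝ := fun k => (max 1 (k : ℝ)) ^ (-2 * (μ₁ - γ * β)) with hw
  refine ⟨Real.sqrt (K₁ * K₂ ^ 2 * (S + 1)), Real.sqrt_pos.2 (by positivity),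
    fun t c M hM ht hc => ?_⟩
  set x : ℕ → ℝ := fun k => (∑ q ∈ t with q.1 = k, seqTerm s μ₁ μ₂ c q) ^ (1 / s) with hx
  have hx0 : ∀ k, 0 ≤ x k := fun k =>
    Real.rpow_nonneg (Finset.sum_nonneg fun q _ => seqTerm_nonneg _ _ _ _ _) _
  have hxs : ∀ k, x k ^ s = ∑ q ∈ t with q.1 = k, seqTerm s μ₁ μ₂ c q := fun k => by
    rw [hx]
    simp only
    rw [← Real.rpow_mul (Finset.sum_nonneg fun q _ => seqTerm_nonneg _ _ _ _ _),
      one_div_mul_cancel hs0.ne', Real.rpow_one]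
  have hrow : ∀ k, rowSum r t c k ^ 2 ≤ K₂ ^ 2 * M ^ (-(2 * β)) * (x k ^ 2 * w k) := by
    intro k
    have hu : 0 < max 1 (k : ℝ) := by positivity
    have h := h₂ t c k (M / (max 1 (k : ℝ)) ^ γ) (by positivity) fun q hq hqk => by
      subst hqk; exact ht q hq
    have e1 : ∑ q ∈ t with q.1 = k, (q.2 : ℝ) ^ (s * μ₂) * |c q| ^ s =
        (max 1 (k : ℝ)) ^ (-(s * μ₁)) * ∑ q ∈ t with q.1 = k, seqTerm s μ₁ μ₂ c q := by
      rw [Finset.mul_sum]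
      refine Finset.sum_congr rfl fun q hq => ?_
      obtain ⟨hqt, rfl⟩ := Finset.mem_filter.1 hq
      have hq2 : (1 : ℝ) ≤ q.2 := by exact_mod_cast (ht q hqt).1
      rw [seqTerm, max_eq_right hq2, Real.rpow_neg hu.le]
      field_simp
    have e2 : (M / (max 1 (k : ℝ)) ^ γ) ^ (-β) = M ^ (-β) * (max 1 (k : ℝ)) ^ (γ * β) := by
      rw [Real.div_rpow hM.le (by positivity), ← Real.rpow_mul hu.le, div_eq_mul_inv,
        ← Real.rpow_neg hu.le]
      congr 2
      ring
    have e3 : ((max 1 (k : ℝ)) ^ (-(s * μ₁)) * ∑ q ∈ t with q.1 = k, seqTerm s μ₁ μ₂ c q) ^ (1 / s)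
        = (max 1 (k : ℝ)) ^ (-μ₁) * x k := by
      rw [Real.mul_rpow (by positivity) (Finset.sum_nonneg fun q _ => seqTerm_nonneg _ _ _ _ _),
        ← Real.rpow_mul hu.le]
      congr 2
      field_simp
    rw [e1, e2, e3] at h
    refine (pow_le_pow_left₀ (rowSum_nonneg _ _ _ _) h 2).trans (le_of_eq ?_)
    have e4 : M ^ (-(2 * β)) = (M ^ (-β)) ^ 2 := by
      rw [← Real.rpow_natCast, ← Real.rpow_mul hM.le]
      congr 1
      push_cast
      ring
    have e5 : w k = ((max 1 (k : ℝ)) ^ (γ * β) * (max 1 (k : ℝ)) ^ (-μ₁)) ^ 2 := by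
      simp only [hw]
      rw [← Real.rpow_add hu, ← Real.rpow_natCast, ← Real.rpow_mul hu.le]
      congr 1
      push_cast
      ring
    rw [e4, e5]
    ring
  have hpt : ∀ k, x k ^ 2 * w k ≤ (max 1 (k : ℝ)) ^ (-σ) + x k ^ s := by
    intro k
    have hu : 0 < max 1 (k : ℝ) := by positivity
    have h := sq_mul_le_add_rpow (s := s) (τ := (max 1 (k : ℝ)) ^ (-(1 / s) - η)) (w := w k)
      hs (by positivity) (by positivity) (hx0 k) (by
        rw [hw, ← Real.rpow_mul hu.le, ← Real.rpow_add hu]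
        refine Real.rpow_le_one_of_one_le_of_nonpos (le_max_left _ _) ?_
        have e : (-(1 / s) - η) * (2 - s) + -2 * (μ₁ - γ * β) = (s - 2) * η - 2 * ε := by
          rw [hε]; field_simp; ring
        have : s * η = ε := by rw [hη]; field_simp
        rw [e]
        nlinarith)
    have e : ((max 1 (k : ℝ)) ^ (-(1 / s) - η)) ^ 2 * w k = (max 1 (k : ℝ)) ^ (-σ) := by
      rw [hw, ← Real.rpow_natCast, ← Real.rpow_mul hu.le, ← Real.rpow_add hu]
      congr 1
      rw [hσ, hε]
      push_cast
      ring
    rwa [e] at h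
  have htot : ∑ k ∈ t.image Prod.fst, x k ^ s ≤ 1 := by
    simp only [hxs]
    rwa [Finset.sum_fiberwise_of_maps_to (fun q hq => Finset.mem_image_of_mem _ hq)]
  have hmain : ‖∑ q ∈ t, c q • derivTensor r q‖ ^ 2 ≤
      K₁ * K₂ ^ 2 * (S + 1) * M ^ (-(2 * β)) := by
    calc _ ≤ K₁ * ∑ k ∈ t.image Prod.fst, rowSum r t c k ^ 2 := h₁ t c fun q hq => (ht q hq).1
      _ ≤ K₁ * ∑ k ∈ t.image Prod.fst,
          K₂ ^ 2 * M ^ (-(2 * β)) * ((max 1 (k : ℝ)) ^ (-σ) + x k ^ s) := by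
          gcongr with k _
          exact (hrow k).trans (by gcongr; exact hpt k)
      _ = K₁ * (K₂ ^ 2 * M ^ (-(2 * β)) * (∑ k ∈ t.image Prod.fst, (max 1 (k : ℝ)) ^ (-σ) +
          ∑ k ∈ t.image Prod.fst, x k ^ s)) := by rw [← Finset.mul_sum, Finset.sum_add_distrib]
      _ ≤ K₁ * (K₂ ^ 2 * M ^ (-(2 * β)) * (S + 1)) := by
          gcongr
          exact hsum.sum_le_tsum _ fun k _ => by positivity
      _ = _ := by ring
  refine abs_le_of_sq_le_sq' ?_ (by positivity) |>.2
  rw [mul_pow, Real.sq_sqrt (by positivity)]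
  refine hmain.trans_eq ?_
  rw [← Real.rpow_natCast (M ^ (-β)), ← Real.rpow_mul hM.le]
  congr 2
  push_cast
  ring

/-- Homogeneity: the coefficients are rescaled by E^{-1/s}. Small E is what the Cauchy criterion for
the derivative series needs. -/
theorem exists_norm_tail_le (r : ℕ) (hr : 1 ≤ r) {s μ₁ μ₂ β γ : ℝ} (hs : 2 ≤ s)
    (hβ0 : 0 < β) (hβ : β = μ₂ - 2 * (r : ℝ) + 1 / s - 1 / 2) (hγ : γ * β < μ₁ + 1 / s - 1 / 2) :
    ∃ K : ℝ, 0 < K ∧ ∀ (t : Finset (ℕ × ℕ)) (c : ℕ × ℕ → ℝ) (M E : ℝ), 0 < M → 0 < E →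
      (∀ q ∈ t, 1 ≤ q.2 ∧ M / (max 1 (q.1 : ℝ)) ^ γ ≤ q.2) →
      ∑ q ∈ t, seqTerm s μ₁ μ₂ c q ≤ E →
      ‖∑ q ∈ t, c q • derivTensor r q‖ ≤ K * M ^ (-β) * E ^ (1 / s) := by
  obtain ⟨K, hK, h⟩ := exists_norm_tail_le_of_sum_le_one r hr hs hβ0 hβ hγ
  refine ⟨K, hK, fun t c M E hM hE ht hc => ?_⟩
  have hs0 : 0 < s := by linarith
  set e := E ^ (1 / s) with he
  have he0 : 0 < e := by positivity
  have hes : e ^ s = E := by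
    rw [he, ← Real.rpow_mul hE.le, one_div_mul_cancel hs0.ne', Real.rpow_one]
  have h1 := h t (fun q => e⁻¹ * c q) M hM ht (by
    have : ∀ q, seqTerm s μ₁ μ₂ (fun q => e⁻¹ * c q) q = E⁻¹ * seqTerm s μ₁ μ₂ c q := by
      intro q
      simp only [seqTerm]
      rw [abs_mul, abs_of_pos (inv_pos.2 he0), Real.mul_rpow (by positivity) (abs_nonneg _),
        Real.inv_rpow he0.le, hes]
      ring
    simp only [this]
    rw [← Finset.mul_sum, inv_mul_le_iff₀ hE, mul_one]
    exact hc)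
  simp only [mul_smul] at h1
  rw [← Finset.smul_sum, norm_smul, Real.norm_eq_abs, abs_of_pos (inv_pos.2 he0),
    inv_mul_le_iff₀ he0] at h1
  linarith

theorem toReal_one_div_le_one {p : ℝ≥0∞} (hp : 1 ≤ p) : (1 / p).toReal ≤ 1 := by
  have : 1 / p ≤ 1 := by rw [one_div]; exact ENNReal.inv_le_one.2 hp
  simpa using ENNReal.toReal_mono ENNReal.one_ne_top this

theorem sum_abs_le_card_rpow_mul_norm {ι : Type*} {p : ℝ≥0∞} (hp : 1 ≤ p)
    (ξ : lp (fun _ : ι => ℝ) p) (T : Finset ι) :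
    ∑ q ∈ T, |ξ q| ≤ (T.card : ℝ) ^ (1 - (1 / p).toReal) * ‖ξ‖ := by
  have hp0 : p ≠ 0 := (zero_lt_one.trans_le hp).ne'
  -- For p = ∞ the convention `(1 / ⊤).toReal = 0` gives the exponent 1, and each entry is bounded
  -- by the norm.
  rcases eq_or_ne p ⊤ with rfl | htop
  · have : ∀ q ∈ T, |ξ q| ≤ ‖ξ‖ := fun q _ => lp.norm_apply_le_norm hp0 ξ q
    simpa using Finset.sum_le_card_nsmul T _ _ this
  · have hp1 : 1 ≤ p.toReal := by
      simpa using ENNReal.toReal_mono htop hp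
    have hpos : 0 < p.toReal := by linarith
    have : Fact (1 ≤ p) := ⟨hp⟩
    have h1 := Real.rpow_sum_le_const_mul_sum_rpow T (fun q => ξ q) hp1
    have h2 := lp.sum_rpow_le_norm_rpow hpos ξ T
    simp only [Real.norm_eq_abs] at h2
    have h3 : (∑ q ∈ T, |ξ q|) ^ p.toReal ≤ (T.card : ℝ) ^ (p.toReal - 1) * ‖ξ‖ ^ p.toReal :=
      h1.trans (by gcongr)
    have h4 := Real.rpow_le_rpow (by positivity) h3 (by positivity : 0 ≤ 1 / p.toReal)
    rw [← Real.rpow_mul (by positivity), mul_one_div_cancel hpos.ne', Real.rpow_one,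
      Real.mul_rpow (by positivity) (by positivity), ← Real.rpow_mul (by positivity),
      ← Real.rpow_mul (norm_nonneg _), mul_one_div_cancel hpos.ne', Real.rpow_one] at h4
    convert h4 using 3
    rw [ENNReal.toReal_div, ENNReal.toReal_one]
    field_simp

/-- Row k has at most J = M/max(1,k)^γ points, so Hölder gives it ‖ξ‖ J^{1-1/p} J^{2r-1/2} = ‖ξ‖
J^ρ. As ρ ≥ 3/2 and γ ≥ 1, the squares are summable over k, and the row k = 0 determines the order.
-/
theorem exists_norm_noise_le (r : ℕ) (hr : 1 ≤ r) {p : ℝ≥0∞} (hp : 1 ≤ p) {γ : ℝ} (hγ : 1 ≤ γ) :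
    ∃ K : ℝ, 0 < K ∧ ∀ (t : Finset (ℕ × ℕ)) (ξ : lp (fun _ : ℕ × ℕ => ℝ) p) (M : ℝ), 0 < M →
      (∀ q ∈ t, 1 ≤ q.2 ∧ q.2 ≤ M / (max 1 (q.1 : ℝ)) ^ γ) →
      ‖∑ q ∈ t, ξ q • derivTensor r q‖ ≤
        K * ‖ξ‖ * M ^ (2 * (r : ℝ) + 1 / 2 - (1 / p).toReal) := by
  obtain ⟨K₁, hK₁, h₁⟩ := exists_norm_sq_sum_derivTensor_le r hr
  set P := (1 / p).toReal with hP
  have hP1 : P ≤ 1 := toReal_one_div_le_one hp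
  have hr' : (1 : ℝ) ≤ r := by exact_mod_cast hr
  set ρ := 2 * (r : ℝ) + 1 / 2 - P with hρ
  have hρ1 : 3 / 2 ≤ ρ := by rw [hρ]; linarith
  have hsum := summable_max_one_rpow_neg (σ := γ * (2 * ρ)) (by nlinarith)
  set S := ∑' k : ℕ, (max 1 (k : ℝ)) ^ (-(γ * (2 * ρ))) with hS
  have hS0 : 0 < S := hsum.tsum_pos (fun k => by positivity) 0 (by positivity)
  refine ⟨Real.sqrt (K₁ * S), Real.sqrt_pos.2 (by positivity), fun t ξ M hM ht => ?_⟩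
  have hrow : ∀ k, rowSum r t ξ k ^ 2 ≤
      ‖ξ‖ ^ 2 * M ^ (2 * ρ) * (max 1 (k : ℝ)) ^ (-(γ * (2 * ρ))) := by
    intro k
    have hu : 0 < max 1 (k : ℝ) := by positivity
    set J := M / (max 1 (k : ℝ)) ^ γ with hJ
    have hJ0 : 0 < J := by positivity
    set T := ({q ∈ t | q.1 = k} : Finset (ℕ × ℕ)) with hT
    have hT' : ∀ q ∈ T, 1 ≤ q.2 ∧ (q.2 : ℝ) ≤ J := by
      intro q hq
      obtain ⟨hqt, rfl⟩ := Finset.mem_filter.1 hq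
      exact ht q hqt
    have hcard : (T.card : ℝ) ≤ J := card_filter_fst_eq_le hJ0.le fun q hq hqk => by
      subst hqk; exact ht q hq
    have h1 : rowSum r t ξ k ≤ ‖ξ‖ * J ^ ρ := by
      calc rowSum r t ξ k ≤ ∑ q ∈ T, |ξ q| * J ^ (2 * (r : ℝ) - 1 / 2) := by
            refine Finset.sum_le_sum fun q hq => ?_
            have := (hT' q hq).2
            gcongr
            linarith
        _ = (∑ q ∈ T, |ξ q|) * J ^ (2 * (r : ℝ) - 1 / 2) := by rw [Finset.sum_mul]
        _ ≤ ((T.card : ℝ) ^ (1 - P) * ‖ξ‖) * J ^ (2 * (r : ℝ) - 1 / 2) := by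
            gcongr
            exact sum_abs_le_card_rpow_mul_norm hp ξ T
        _ ≤ (J ^ (1 - P) * ‖ξ‖) * J ^ (2 * (r : ℝ) - 1 / 2) := by
            have : 0 ≤ 1 - P := by linarith
            have : 0 ≤ ‖ξ‖ := lp.norm_nonneg' ξ
            gcongr
        _ = ‖ξ‖ * J ^ ρ := by
            rw [mul_comm _ ‖ξ‖, mul_assoc, ← Real.rpow_add hJ0]
            congr 2
            rw [hρ]
            ring
    refine (pow_le_pow_left₀ (rowSum_nonneg _ _ _ _) h1 2).trans (le_of_eq ?_)
    rw [mul_pow, ← Real.rpow_natCast (J ^ ρ), ← Real.rpow_mul hJ0.le, hJ,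
      Real.div_rpow hM.le (by positivity), ← Real.rpow_mul hu.le, Real.rpow_neg hu.le]
    push_cast
    rw [mul_comm ρ 2]
    ring
  have hmain : ‖∑ q ∈ t, ξ q • derivTensor r q‖ ^ 2 ≤ K₁ * S * ‖ξ‖ ^ 2 * M ^ (2 * ρ) := by
    calc _ ≤ K₁ * ∑ k ∈ t.image Prod.fst, rowSum r t ξ k ^ 2 := h₁ t ξ fun q hq => (ht q hq).1
      _ ≤ K₁ * ∑ k ∈ t.image Prod.fst,
          ‖ξ‖ ^ 2 * M ^ (2 * ρ) * (max 1 (k : ℝ)) ^ (-(γ * (2 * ρ))) := by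
          gcongr with k _
          exact hrow k
      _ = K₁ * (‖ξ‖ ^ 2 * M ^ (2 * ρ) *
          ∑ k ∈ t.image Prod.fst, (max 1 (k : ℝ)) ^ (-(γ * (2 * ρ)))) := by rw [← Finset.mul_sum]
      _ ≤ K₁ * (‖ξ‖ ^ 2 * M ^ (2 * ρ) * S) := by
          gcongr
          exact hsum.sum_le_tsum _ fun k _ => by positivity
      _ = _ := by ring
  have hξ : 0 ≤ ‖ξ‖ := lp.norm_nonneg' ξ
  refine abs_le_of_sq_le_sq' ?_ (by positivity) |>.2
  rw [mul_pow, mul_pow, Real.sq_sqrt (by positivity), ← Real.rpow_natCast (M ^ ρ),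
    ← Real.rpow_mul hM.le]
  push_cast
  rw [mul_comm ρ 2]
  exact hmain

end RowEstimates

/-! ### Error of truncation from above, minimal radius from below. -/

section ErrorBounds

open Filter Topology

theorem summable_derivTerm_of_summable (r : ℕ) (hr : 1 ≤ r) {s μ₁ μ₂ : ℝ} (hs : 2 ≤ s)
    (hμ₂ : 2 * (r : ℝ) - 1 / s + 1 / 2 < μ₂) (hμ₁ : μ₂ - 2 * (r : ℝ) < μ₁) {f : L2Q}
    (hf : Summable (weightedTerm s μ₁ μ₂ f)) : Summable (derivTerm r f) := by
  obtain ⟨K, hK, h⟩ := exists_norm_tail_le r hr (μ₁ := μ₁) (μ₂ := μ₂) (γ := 1) hs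
    (by linarith : 0 < μ₂ - 2 * (r : ℝ) + 1 / s - 1 / 2) rfl (by linarith)
  have hs0 : 0 < s := by linarith
  rw [summable_iff_vanishing_norm]
  intro ε hε
  have hE : 0 < (ε / (2 * K)) ^ s := by positivity
  have hsub : Summable fun q : {q : ℕ × ℕ // r ≤ q.2} => weightedTerm s μ₁ μ₂ f q :=
    hf.subtype {q : ℕ × ℕ | r ≤ q.2}
  obtain ⟨u, hu⟩ := summable_iff_vanishing_norm.1 hsub _ hE
  refine ⟨u, fun t ht => ?_⟩
  -- With M = γ = 1 the cut-off condition is void; all smallness comes from E, which yields the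
  -- bound ε/2.
  have h1 := h (t.map (Function.Embedding.subtype _)) (coef f) 1 _ one_pos hE (by
    intro q hq
    obtain ⟨q', _, rfl⟩ := Finset.mem_map.1 hq
    have hq1 : 1 ≤ q'.1.2 := hr.trans q'.2
    refine ⟨hq1, ?_⟩
    have : (1 : ℝ) ≤ q'.1.2 := by exact_mod_cast hq1
    rw [Real.rpow_one]
    refine le_trans ?_ this
    rw [Function.Embedding.subtype_apply, div_le_one (by positivity)]
    exact le_max_left _ _) (by
    rw [Finset.sum_map]
    exact (le_abs_self _).trans (hu t ht).le)
  rw [Finset.sum_map, Real.one_rpow, ← Real.rpow_mul (by positivity), mul_one_div_cancel hs0.ne',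
    Real.rpow_one] at h1
  refine lt_of_le_of_lt h1 ?_
  field_simp
  linarith

theorem tsum_weightedTerm_le_one {s μ₁ μ₂ : ℝ} (hs : 0 < s) {f : L2Q}
    (hf : f ∈ functionClass s μ₁ μ₂) : ∑' q, weightedTerm s μ₁ μ₂ f q ≤ 1 := by
  by_contra hlt
  exact absurd hf.2 (not_le.2 (Real.one_lt_rpow (not_le.1 hlt) (by positivity)))

theorem div_rpow_le_of_mem_hyperbolicCross {r n : ℕ} {γ : ℝ} (hγ : 1 ≤ γ) {q : ℕ × ℕ}
    (hq : q ∈ hyperbolicCross r n γ) : (q.2 : ℝ) ≤ n / (max 1 (q.1 : ℝ)) ^ γ := by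
  rw [mem_hyperbolicCross r n γ hγ] at hq
  obtain ⟨h1, -, -, h4⟩ := hq
  rcases Nat.eq_zero_or_pos q.1 with h0 | h0
  · rw [h0]
    simpa using h4
  · have h0' : (1 : ℝ) ≤ q.1 := by exact_mod_cast h0
    rw [max_eq_right h0', le_div_iff₀ (by positivity), mul_comm]
    exact h1

/-- The bound k ≤ n^{1/γ} is implied by k^γ j ≤ n and j ≥ 1, so leaving the cross means j ≥
n/max(1,k)^γ. For n = 0 the cross is empty, and `max 1 n` keeps negative powers of the parameter
meaningful. -/
theorem div_rpow_le_of_notMem_hyperbolicCross {r n : ℕ} (hr : 1 ≤ r) {γ : ℝ} (hγ : 1 ≤ γ)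
    {q : ℕ × ℕ} (hqr : r ≤ q.2) (hq : q ∉ hyperbolicCross r n γ) :
    max 1 (n : ℝ) / (max 1 (q.1 : ℝ)) ^ γ ≤ q.2 := by
  rw [mem_hyperbolicCross r n γ hγ] at hq
  have hγ0 : 0 < γ := by linarith
  have hq2 : (1 : ℝ) ≤ q.2 := by exact_mod_cast hr.trans hqr
  rw [div_le_iff₀ (by positivity)]
  have hu1 : 1 ≤ (max 1 (q.1 : ℝ)) ^ γ := Real.one_le_rpow (le_max_left _ _) hγ0.le
  refine max_le (by nlinarith) ?_
  by_contra hcon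
  rw [not_le] at hcon
  refine hq ⟨?_, ?_, hqr, ?_⟩
  · have : (q.1 : ℝ) ^ γ ≤ (max 1 (q.1 : ℝ)) ^ γ := by gcongr; exact le_max_right _ _
    nlinarith
  · have h1 : (q.1 : ℝ) ^ γ ≤ n := by
      have : (q.1 : ℝ) ^ γ ≤ (max 1 (q.1 : ℝ)) ^ γ := by gcongr; exact le_max_right _ _
      nlinarith
    have h2 := Real.rpow_le_rpow (by positivity) h1 (by positivity : 0 ≤ 1 / γ)
    rwa [← Real.rpow_mul (by positivity), mul_one_div_cancel hγ0.ne', Real.rpow_one] at h2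
  · have : (q.2 : ℝ) ≤ n := by nlinarith
    exact_mod_cast this

theorem exists_truncationError_le (r : ℕ) (hr : 1 ≤ r) {s μ₁ μ₂ a β γ : ℝ} {p : ℝ≥0∞}
    (hs : 2 ≤ s) (hp : 1 ≤ p) (hμ₂ : 2 * (r : ℝ) - 1 / s + 1 / 2 < μ₂)
    (hμ₁ : μ₂ - 2 * (r : ℝ) < μ₁) (ha : a = μ₂ - (1 / p).toReal + 1 / s)
    (hβ : β = μ₂ - 2 * (r : ℝ) + 1 / s - 1 / 2) (hγ1 : 1 ≤ γ)
    (hγ : γ * β < μ₁ + 1 / s - 1 / 2) :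
    ∃ K : ℝ, 0 < K ∧ ∀ (n : ℕ) (δ : ℝ), truncationError r s μ₁ μ₂ p δ n γ ≤
      ENNReal.ofReal (K * ((max 1 (n : ℝ)) ^ (-β) + δ * (max 1 (n : ℝ)) ^ (a - β))) := by
  obtain ⟨K₁, hK₁, h₁⟩ := exists_norm_tail_le r hr hs (by linarith) hβ hγ
  obtain ⟨K₂, hK₂, h₂⟩ := exists_norm_noise_le r hr hp hγ1
  refine ⟨max K₁ K₂, by positivity, fun n δ => ?_⟩
  set m : ℝ := max 1 (n : ℝ) with hm
  have hm0 : 0 < m := by positivity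
  unfold truncationError algError
  refine iSup₂_le fun f hf => iSup₂_le fun g hg => ?_
  obtain ⟨ξ, hξδ, hξ⟩ := hg
  have hξ0 : 0 ≤ ‖ξ‖ := lp.norm_nonneg' ξ
  set Γ := hyperbolicCross r n γ with hΓ
  have hmem : ∀ q ∈ Γ, r ≤ q.2 := fun q hq => ((mem_hyperbolicCross r n γ hγ1 q).1 hq).2.2.1
  have htr : truncation r n γ (info Γ g) = ∑ q ∈ Γ, g q • derivTensor r q := by
    rw [truncation]
    exact Finset.sum_coe_sort Γ fun q => g q • derivTensor r q
  have hnoise : ‖∑ q ∈ Γ, ξ q • derivTensor r q‖ ≤ K₂ * δ * m ^ (a - β) := by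
    have h := h₂ Γ ξ m hm0 fun q hq => ⟨hr.trans (hmem q hq),
      (div_rpow_le_of_mem_hyperbolicCross hγ1 hq).trans (by gcongr; exact le_max_right _ _)⟩
    refine h.trans ?_
    have e : 2 * (r : ℝ) + 1 / 2 - (1 / p).toReal = a - β := by rw [ha, hβ]; ring
    rw [e]
    gcongr
  -- The tail estimate concerns finite sets but is uniform in them, so it passes to the limit along
  -- finite sets containing the cross.
  have hlim : Tendsto (fun t : Finset {q : ℕ × ℕ // r ≤ q.2} =>
      ‖∑ q ∈ t, derivTerm r f q - ∑ q ∈ Γ, g q • derivTensor r q‖) atTop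
      (𝓝 ‖partialDeriv r f - ∑ q ∈ Γ, g q • derivTensor r q‖) :=
    ((summable_derivTerm_of_summable r hr hs hμ₂ hμ₁ hf.1).hasSum.sub_const _).norm
  have hle : ‖partialDeriv r f - ∑ q ∈ Γ, g q • derivTensor r q‖ ≤
      K₁ * m ^ (-β) + K₂ * δ * m ^ (a - β) := by
    refine le_of_tendsto hlim ?_
    filter_upwards [eventually_ge_atTop (Γ.subtype fun q => r ≤ q.2)] with t ht
    set T := t.map (Function.Embedding.subtype _) with hT
    have hΓT : Γ ⊆ T := by
      intro q hq
      rw [hT, Finset.mem_map]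
      exact ⟨⟨q, hmem q hq⟩, ht (Finset.mem_subtype.2 hq), rfl⟩
    have hsumT : ∑ q ∈ t, derivTerm r f q = ∑ q ∈ T, coef f q • derivTensor r q := by
      rw [hT, Finset.sum_map]
      rfl
    have hdecomp : ∑ q ∈ T, coef f q • derivTensor r q - ∑ q ∈ Γ, g q • derivTensor r q =
        ∑ q ∈ T \ Γ, coef f q • derivTensor r q + ∑ q ∈ Γ, ξ q • derivTensor r q := by
      rw [← Finset.sum_sdiff hΓT, add_sub_assoc, ← Finset.sum_sub_distrib]
      simp only [hξ, sub_smul]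
    rw [hsumT, hdecomp]
    refine (norm_add_le _ _).trans (add_le_add ?_ hnoise)
    have h := h₁ (T \ Γ) (coef f) m 1 hm0 one_pos (by
      intro q hq
      obtain ⟨hqT, hqΓ⟩ := Finset.mem_sdiff.1 hq
      obtain ⟨q', _, rfl⟩ := Finset.mem_map.1 hqT
      exact ⟨hr.trans q'.2, div_rpow_le_of_notMem_hyperbolicCross hr hγ1 q'.2 hqΓ⟩)
      ((hf.1.sum_le_tsum _ fun q _ => seqTerm_nonneg _ _ _ _ q).trans
        (tsum_weightedTerm_le_one (by linarith) hf))
    rwa [Real.one_rpow, mul_one] at h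
  rw [htr, ← ofReal_norm]
  refine ENNReal.ofReal_le_ofReal (hle.trans ?_)
  have hδ : 0 ≤ δ := hξ0.trans hξδ
  rw [mul_add, mul_assoc]
  gcongr
  · exact le_max_left _ _
  · exact le_max_right _ _

theorem minRadius_le_truncationError {r n N : ℕ} {γ : ℝ} (hγ : 1 ≤ γ) (s μ₁ μ₂ : ℝ) (p : ℝ≥0∞)
    (δ : ℝ) (h : (hyperbolicCross r n γ).card ≤ N) :
    minRadius r s μ₁ μ₂ p N δ ≤ truncationError r s μ₁ μ₂ p δ n γ :=
  (iInf₂_le (hyperbolicCross r n γ)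
    ⟨fun q hq => ((mem_hyperbolicCross r n γ hγ q).1 hq).2.2.1, h⟩).trans (iInf_le _ _)

theorem weightedTerm_neg (s μ₁ μ₂ : ℝ) (f : L2Q) :
    weightedTerm s μ₁ μ₂ (-f) = weightedTerm s μ₁ μ₂ f := by
  ext q
  simp only [weightedTerm, coef_neg, abs_neg]

theorem neg_mem_functionClass {s μ₁ μ₂ : ℝ} {f : L2Q} (hf : f ∈ functionClass s μ₁ μ₂) :
    -f ∈ functionClass s μ₁ μ₂ :=
  ⟨by rw [weightedTerm_neg]; exact hf.1, by rw [classNorm, weightedTerm_neg]; exact hf.2⟩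

theorem partialDeriv_neg (r : ℕ) (f : L2Q) : partialDeriv r (-f) = -partialDeriv r f := by
  rw [partialDeriv, partialDeriv, ← tsum_neg]
  congr 1
  ext1 q
  rw [derivTerm, derivTerm, coef_neg, neg_smul]

theorem isPerturbation_coef (p : ℝ≥0∞) {δ : ℝ} (hδ : 0 ≤ δ) (f : L2Q) :
    IsPerturbation p δ f (coef f) :=
  ⟨0, by simpa using hδ, fun q => by simp⟩

/-- A function of the class whose coefficients vanish on `Ω` cannot be distinguished from its
negative, so that the norm of its derivative bounds every error from below. -/
theorem enorm_partialDeriv_le_algError {r : ℕ} {s μ₁ μ₂ : ℝ} (p : ℝ≥0∞) {δ : ℝ}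
    (hδ : 0 ≤ δ) {Ω : Finset (ℕ × ℕ)} (ψ : (Ω → ℝ) → L2Q) {f : L2Q}
    (hf : f ∈ functionClass s μ₁ μ₂) (h0 : ∀ q ∈ Ω, coef f q = 0) :
    ‖partialDeriv r f‖ₑ ≤ algError r s μ₁ μ₂ p δ Ω ψ := by
  have hle : ∀ f ∈ functionClass s μ₁ μ₂, (∀ q ∈ Ω, coef f q = 0) →
      ‖partialDeriv r f - ψ 0‖ₑ ≤ algError r s μ₁ μ₂ p δ Ω ψ := by
    intro f hf h0
    have hi : info Ω (coef f) = 0 := funext fun q => h0 q.1 q.2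
    have h1 : ‖partialDeriv r f - ψ (info Ω (coef f))‖ₑ ≤ algError r s μ₁ μ₂ p δ Ω ψ :=
      le_iSup₂_of_le f hf (le_iSup₂_of_le (coef f) (isPerturbation_coef p hδ f) le_rfl)
    rwa [hi] at h1
  have h1 := hle f hf h0
  have h2 := hle (-f) (neg_mem_functionClass hf) fun q hq => by rw [coef_neg, h0 q hq, neg_zero]
  rw [partialDeriv_neg] at h2
  set D := partialDeriv r f
  set y := ψ 0
  -- From 2D = (D - y) - (-D - y), the larger of the two errors is at least ‖D‖.
  rcases le_total ‖D - y‖ ‖-D - y‖ with h | h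
  · refine le_trans ?_ h2
    rw [enorm_le_iff_norm_le]
    have e : (2 : ℝ) • D = (D - y) - (-D - y) := by rw [two_smul]; abel
    have := norm_sub_le (D - y) (-D - y)
    rw [← e, norm_smul, Real.norm_two] at this
    linarith
  · refine le_trans ?_ h1
    rw [enorm_le_iff_norm_le]
    have e : (2 : ℝ) • D = (D - y) - (-D - y) := by rw [two_smul]; abel
    have := norm_sub_le (D - y) (-D - y)
    rw [← e, norm_smul, Real.norm_two] at this
    linarith

/-- The function `c ∑_{j ∈ T} φ_0(t) φ_j(τ)`. -/
noncomputable def rowFunction (c : ℝ) (T : Finset ℕ) : L2Q :=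
  c • ∑ j ∈ T, tensor (legendre 0) (legendre j)

theorem coef_rowFunction (c : ℝ) (T : Finset ℕ) (q : ℕ × ℕ) :
    coef (rowFunction c T) q = if q ∈ T.map ⟨Prod.mk 0, Prod.mk_right_injective 0⟩ then c else 0 := by
  have h : ∀ j, coef (tensor (legendre 0) (legendre j)) q = if (0, j) = q then 1 else 0 :=
    fun j => coef_tensor_legendre q (0, j)
  rw [rowFunction, coef_smul, coef_sum]
  simp only [h]
  split_ifs with hq
  · obtain ⟨j, hj, rfl⟩ := Finset.mem_map.1 hq
    rw [Finset.sum_eq_single_of_mem j hj]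
    · simp
    · intro i _ hi
      simp [hi]
  · rw [Finset.sum_eq_zero, mul_zero]
    intro j hj
    rw [if_neg]
    rintro rfl
    exact hq (Finset.mem_map_of_mem _ hj)

/-- On the row k = 0 the weight in the first index is 1, so μ₁ plays no role. -/
theorem rowFunction_mem_functionClass {s μ₁ μ₂ c : ℝ} (hs : 0 < s) (hμ₂ : 0 < μ₂) (hc : 0 ≤ c)
    {T : Finset ℕ} {M A : ℝ} (hM : 1 ≤ M) (hA : (T.card : ℝ) ≤ A) (hT : ∀ j ∈ T, (j : ℝ) ≤ M)
    (h : A * (M ^ (s * μ₂) * c ^ s) ≤ 1) : rowFunction c T ∈ functionClass s μ₁ μ₂ := by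
  set T' := T.map ⟨Prod.mk 0, Prod.mk_right_injective 0⟩ with hT'
  have h0 : ∀ q ∉ T', weightedTerm s μ₁ μ₂ (rowFunction c T) q = 0 := by
    intro q hq
    rw [weightedTerm, coef_rowFunction, if_neg hq, abs_zero, Real.zero_rpow hs.ne', mul_zero]
  refine ⟨summable_of_ne_finset_zero h0, ?_⟩
  rw [classNorm, tsum_eq_sum h0]
  refine Real.rpow_le_one (Finset.sum_nonneg fun q _ => seqTerm_nonneg _ _ _ _ q) ?_
    (by positivity)
  rw [hT', Finset.sum_map]
  refine (Finset.sum_le_card_nsmul _ _ (M ^ (s * μ₂) * c ^ s) fun j hj => ?_).trans ?_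
  · rw [weightedTerm, coef_rowFunction, if_pos (Finset.mem_map_of_mem _ hj), abs_of_nonneg hc]
    simp only [Function.Embedding.coeFn_mk, Nat.cast_zero]
    rw [max_eq_left zero_le_one, Real.one_rpow, one_mul]
    gcongr
    exact max_le hM (hT j hj)
  · rw [nsmul_eq_mul]
    refine le_trans ?_ h
    gcongr

theorem partialDeriv_rowFunction {r : ℕ} (c : ℝ) {T : Finset ℕ} (hT : ∀ j ∈ T, r ≤ j) :
    partialDeriv r (rowFunction c T) =
      c • tensor (legendre 0) (∑ j ∈ T, Polynomial.derivative^[r] (legendre j)) := by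
  set T' := T.map ⟨Prod.mk 0, Prod.mk_right_injective 0⟩ with hT'
  have h0 : ∀ q ∉ T', coef (rowFunction c T) q • derivTensor r q = 0 := by
    intro q hq
    rw [coef_rowFunction, if_neg hq, zero_smul]
  have hsupp : Function.support (fun q => coef (rowFunction c T) q • derivTensor r q) ⊆
      {q | r ≤ q.2} := by
    intro q hq
    by_contra hcon
    refine hq (h0 q fun hqT => ?_)
    obtain ⟨j, hj, rfl⟩ := Finset.mem_map.1 hqT
    exact hcon (hT j hj)
  have h1 : partialDeriv r (rowFunction c T) =
      ∑' q, coef (rowFunction c T) q • derivTensor r q := tsum_subtype_eq_of_support_subset hsupp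
  rw [h1, tsum_eq_sum h0, hT', Finset.sum_map, tensor_sum_right, Finset.smul_sum]
  refine Finset.sum_congr rfl fun j hj => ?_
  rw [coef_rowFunction, if_pos (Finset.mem_map_of_mem _ hj)]
  rfl

/-- At least M/2 positive values of order M^{2r+1/2} add up at the point 1, and the Nikolskii
inequality for degree below 2M costs a factor of order M. Orthogonal derivatives would allow only
the order M^{2r}; this concentration at the end point makes the triangle inequality within a row
sharp. -/
theorem exists_le_norm_tensor_sum_derivative (r : ℕ) :
    ∃ K : ℝ, 0 < K ∧ ∀ (M : ℕ) (T : Finset ℕ), 1 ≤ M → 2 * r ≤ M → T ⊆ Finset.Ico M (2 * M) →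
      (M : ℝ) / 2 ≤ T.card →
      K * (M : ℝ) ^ (2 * (r : ℝ) + 1 / 2) ≤
        ‖tensor (legendre 0) (∑ j ∈ T, Polynomial.derivative^[r] (legendre j))‖ := by
  set κ : ℝ := ((2 : ℝ) ^ r * 2 ^ r * r.factorial * 2 ^ r)⁻¹ with hκ
  have hκ0 : 0 < κ := by positivity
  -- The argument yields (M/2)κz ≤ √2 M‖·‖ with z = M^{2r+1/2}, hence the constant κ/(2√2) ≥ κ/4.
  refine ⟨κ / 4, by positivity, fun M T hM1 hM hT hcard => ?_⟩
  have hM0 : (0 : ℝ) < M := by exact_mod_cast hM1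
  set P := ∑ j ∈ T, Polynomial.derivative^[r] (legendre j) with hP
  have hdeg : P.degree < ((2 * M : ℕ) : WithBot ℕ) := by
    refine (Polynomial.degree_sum_le _ _).trans_lt ?_
    rw [Finset.sup_lt_iff (WithBot.bot_lt_coe _)]
    intro j hj
    have h1 := (Finset.mem_Ico.1 (hT hj)).2
    have h2 := natDegree_legendre_le j
    have h3 := Polynomial.natDegree_iterate_derivative (legendre j) r
    exact Polynomial.degree_le_natDegree.trans_lt (by norm_cast; omega)
  have heval : (M : ℝ) / 2 * (κ * (M : ℝ) ^ (2 * r) * Real.sqrt M) ≤ P.eval 1 := by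
    rw [hP, Polynomial.eval_finsetSum]
    calc _ ≤ (T.card : ℝ) * (κ * (M : ℝ) ^ (2 * r) * Real.sqrt M) := by gcongr
      _ = T.card • (κ * (M : ℝ) ^ (2 * r) * Real.sqrt M) := (nsmul_eq_mul _ _).symm
      _ ≤ _ := by
        refine Finset.card_nsmul_le_sum _ _ _ fun j hj => ?_
        have h1 := (Finset.mem_Ico.1 (hT hj)).1
        refine le_trans ?_ (le_eval_one_iterate_derivative_legendre r j (hM.trans h1))
        gcongr
  have hnik := sq_eval_one_le_polyInner (2 * M) hdeg
  rw [← norm_sq_tensor_legendre_left 0 P] at hnik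
  have h1 := (pow_le_pow_left₀ (by positivity) heval 2).trans hnik
  have e : (M : ℝ) ^ (2 * (r : ℝ) + 1 / 2) = (M : ℝ) ^ (2 * r) * Real.sqrt M := by
    rw [Real.rpow_add hM0, Real.sqrt_eq_rpow, ← Real.rpow_natCast]
    push_cast
    rfl
  rw [e]
  refine abs_le_of_sq_le_sq' ?_ (norm_nonneg _) |>.2
  set y := ‖tensor (legendre 0) P‖
  set z := (M : ℝ) ^ (2 * r) * Real.sqrt M
  have h2 : (M : ℝ) ^ 2 * (κ / 4 * z) ^ 2 * 8 ≤ (M : ℝ) ^ 2 * y ^ 2 * 4 := by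
    push_cast at h1
    have : (M / 2 * (κ * (M : ℝ) ^ (2 * r) * Real.sqrt M)) ^ 2 =
      (M : ℝ) ^ 2 * (κ / 4 * z) ^ 2 * 4 := by ring
    rw [this] at h1
    linarith
  have h3 : 0 < (M : ℝ) ^ 2 := by positivity
  have h4 : (κ / 4 * z) ^ 2 * 8 ≤ y ^ 2 * 4 := by
    rw [mul_assoc, mul_assoc] at h2
    exact le_of_mul_le_mul_left h2 h3
  nlinarith [sq_nonneg (κ / 4 * z)]

theorem card_filter_notMem_ge {N M : ℕ} (hM : 2 * N ≤ M) {Ω : Finset (ℕ × ℕ)} (hΩ : Ω.card ≤ N) :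
    (M : ℝ) / 2 ≤ (((Finset.Ico M (2 * M)).filter fun j => (0, j) ∉ Ω).card : ℝ) := by
  have h1 : ((Finset.Ico M (2 * M)).filter fun j => (0, j) ∈ Ω).card ≤ Ω.card :=
    Finset.card_le_card_of_injOn (Prod.mk 0) (fun j hj => (Finset.mem_filter.1 hj).2)
      (Prod.mk_right_injective 0).injOn
  have h2 := Finset.card_filter_add_card_filter_not (s := Finset.Ico M (2 * M))
    (fun j => (0, j) ∈ Ω)
  rw [Nat.card_Ico] at h2
  have h3 : M ≤ 2 * ((Finset.Ico M (2 * M)).filter fun j => (0, j) ∉ Ω).card := by omega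
  have h4 : (M : ℝ) ≤ 2 * (((Finset.Ico M (2 * M)).filter fun j => (0, j) ∉ Ω).card : ℝ) := by
    exact_mod_cast h3
  linarith

theorem exists_le_minRadius (r : ℕ) (hr : 1 ≤ r) {s μ₂ β : ℝ} (μ₁ : ℝ) (p : ℝ≥0∞) (hs : 0 < s)
    (hμ₂0 : 0 < μ₂) (hβ : β = μ₂ - 2 * (r : ℝ) + 1 / s - 1 / 2) :
    ∃ K : ℝ, 0 < K ∧ ∀ (N : ℕ) (δ : ℝ), 1 ≤ N → 0 ≤ δ →
      ENNReal.ofReal (K * (N : ℝ) ^ (-β)) ≤ minRadius r s μ₁ μ₂ p N δ := by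
  obtain ⟨K, hK, h⟩ := exists_le_norm_tensor_sum_derivative r
  have hr0 : (0 : ℝ) < r := by exact_mod_cast hr
  refine ⟨2 ^ (-μ₂) * K * (2 * r) ^ (-β), by positivity, fun N δ hN hδ => ?_⟩
  unfold minRadius
  refine le_iInf₂ fun Ω hΩ => le_iInf fun ψ => ?_
  -- M ≥ 2N lets at least half of the block [M, 2M) escape Ω, and M ≥ 2r is needed for the end-point
  -- bound.
  set M := 2 * r * N with hM
  have hM1 : 2 * N ≤ M := by rw [hM]; nlinarith
  have hMr : 2 * r ≤ M := Nat.le_mul_of_pos_right _ hN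
  have hM0 : (0 : ℝ) < M := by exact_mod_cast (by omega : 0 < M)
  have hMge : (1 : ℝ) ≤ M := by exact_mod_cast (by omega : 1 ≤ M)
  set T := (Finset.Ico M (2 * M)).filter fun j => (0, j) ∉ Ω with hT
  have hTsub : T ⊆ Finset.Ico M (2 * M) := Finset.filter_subset _ _
  -- Normalised so that M (2M)^{sμ₂} c^s = 1, the class condition for at most M indices below 2M.
  set c : ℝ := (M : ℝ) ^ (-(1 / s)) * (2 * (M : ℝ)) ^ (-μ₂) with hc
  have hc0 : 0 ≤ c := by positivity
  have hmem : rowFunction c T ∈ functionClass s μ₁ μ₂ := by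
    refine rowFunction_mem_functionClass hs hμ₂0 hc0 (M := 2 * M) (A := M) (by linarith) ?_ ?_ ?_
    · have := Finset.card_le_card hTsub
      rw [Nat.card_Ico] at this
      exact_mod_cast (by omega : T.card ≤ M)
    · intro j hj
      have := (Finset.mem_Ico.1 (hTsub hj)).2
      exact_mod_cast this.le
    · have hcs : c ^ s = (M : ℝ)⁻¹ * ((2 * (M : ℝ)) ^ (s * μ₂))⁻¹ := by
        rw [hc, Real.mul_rpow (by positivity) (by positivity), ← Real.rpow_mul hM0.le,
          ← Real.rpow_mul (by positivity), neg_mul, one_div_mul_cancel hs.ne', Real.rpow_neg_one,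
          neg_mul, mul_comm μ₂, Real.rpow_neg (by positivity)]
      rw [hcs]
      have : (2 * (M : ℝ)) ^ (s * μ₂) ≠ 0 := by positivity
      generalize (2 * (M : ℝ)) ^ (s * μ₂) = y at this ⊢
      field_simp
      exact le_rfl
  have hzero : ∀ q ∈ Ω, coef (rowFunction c T) q = 0 := by
    intro q hq
    rw [coef_rowFunction, if_neg]
    intro hqT
    obtain ⟨j, hj, rfl⟩ := Finset.mem_map.1 hqT
    exact (Finset.mem_filter.1 hj).2 hq
  refine le_trans ?_ (enorm_partialDeriv_le_algError p hδ ψ hmem hzero)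
  rw [partialDeriv_rowFunction c fun j hj => by
    have := (Finset.mem_Ico.1 (hTsub hj)).1; omega, ← ofReal_norm]
  refine ENNReal.ofReal_le_ofReal ?_
  rw [norm_smul, Real.norm_eq_abs, abs_of_nonneg hc0]
  refine le_trans (le_of_eq ?_) (mul_le_mul_of_nonneg_left
    (h M T (by omega) hMr hTsub (card_filter_notMem_ge hM1 hΩ.2)) hc0)
  have e1 : (M : ℝ) ^ (-β) = (2 * r) ^ (-β) * (N : ℝ) ^ (-β) := by
    rw [← Real.mul_rpow (by positivity) (by positivity), hM]
    push_cast
    rfl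
  have e2 : (M : ℝ) ^ (-β) = (M : ℝ) ^ (-(1 / s)) * (M : ℝ) ^ (-μ₂) *
      (M : ℝ) ^ (2 * (r : ℝ) + 1 / 2) := by
    rw [← Real.rpow_add hM0, ← Real.rpow_add hM0, hβ]
    congr 1
    ring
  rw [mul_assoc, ← e1, e2, hc, Real.mul_rpow (by norm_num) hM0.le]
  ring

end ErrorBounds

/-! ### Cardinality of the hyperbolic cross. -/

section HyperbolicCross

theorem card_hyperbolicCross_le_sum {r : ℕ} (hr : 1 ≤ r) {γ : ℝ} (hγ : 1 ≤ γ) (n : ℕ) :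
    ((hyperbolicCross r n γ).card : ℝ) ≤
      n * ∑ k ∈ Finset.range (n + 1), (max 1 (k : ℝ)) ^ (-γ) := by
  have hmaps : (hyperbolicCross r n γ : Set (ℕ × ℕ)).MapsTo Prod.fst (Finset.range (n + 1)) :=
    fun q hq => (Finset.mem_product.1 (Finset.mem_filter.1 hq).1).1
  rw [Finset.card_eq_sum_card_fiberwise hmaps, Finset.mul_sum]
  push_cast
  refine Finset.sum_le_sum fun k _ => ?_
  rw [Real.rpow_neg (by positivity), ← div_eq_mul_inv]
  refine card_filter_fst_eq_le (by positivity) fun q hq hqk => ?_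
  subst hqk
  exact ⟨hr.trans ((mem_hyperbolicCross r n γ hγ q).1 hq).2.2.1,
    div_rpow_le_of_mem_hyperbolicCross hγ hq⟩

theorem exists_card_hyperbolicCross_le {r : ℕ} (hr : 1 ≤ r) {γ : ℝ} (hγ : 1 < γ) :
    ∃ K : ℝ, 1 ≤ K ∧ ∀ n : ℕ, ((hyperbolicCross r n γ).card : ℝ) ≤ K * n := by
  refine ⟨max 1 (∑' k : ℕ, (max 1 (k : ℝ)) ^ (-γ)), le_max_left _ _, fun n => ?_⟩
  refine (card_hyperbolicCross_le_sum hr hγ.le n).trans ?_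
  rw [mul_comm]
  gcongr
  exact ((summable_max_one_rpow_neg hγ).sum_le_tsum _ fun k _ => by positivity).trans
    (le_max_right _ _)

/-- The row k = 0 contributes n and the others n times a harmonic number, at most 1 + ln n. -/
theorem card_hyperbolicCross_one_le {r : ℕ} (hr : 1 ≤ r) (n : ℕ) :
    ((hyperbolicCross r n 1).card : ℝ) ≤ n * (2 + Real.log n) := by
  refine (card_hyperbolicCross_le_sum hr le_rfl n).trans ?_
  gcongr
  have h := harmonic_le_one_add_log n
  rw [harmonic] at h
  push_cast at h
  rw [Finset.sum_range_succ']
  have e : ∀ k : ℕ, (max 1 ((k + 1 : ℕ) : ℝ)) ^ (-1 : ℝ) = ((k : ℝ) + 1)⁻¹ := by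
    intro k
    have : (0 : ℝ) ≤ k := k.cast_nonneg
    rw [Real.rpow_neg_one, max_eq_right] <;> push_cast
    · rfl
    · linarith
  simp only [e]
  simp
  linarith

theorem natCast_div_le_div_add_one (m n : ℕ) : (m : ℝ) / n ≤ ((m / n : ℕ) : ℝ) + 1 := by
  rw [← Nat.floor_div_eq_div (K := ℝ)]
  exact (Nat.lt_floor_add_one _).le

/-- The row k = 0 alone already has enough points. -/
theorem half_le_card_hyperbolicCross {r n : ℕ} {γ : ℝ} (hγ : 1 ≤ γ) (hn : 2 * r ≤ n) :
    (n : ℝ) / 2 ≤ (hyperbolicCross r n γ).card := by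
  have h : (Finset.Icc r n).card ≤ (hyperbolicCross r n γ).card := by
    refine Finset.card_le_card_of_injOn (Prod.mk 0) (fun j hj => ?_)
      (Prod.mk_right_injective 0).injOn
    have hj := Finset.mem_Icc.1 (Finset.mem_coe.1 hj)
    rw [Finset.mem_coe, mem_hyperbolicCross r n γ hγ]
    refine ⟨?_, ?_, hj.1, hj.2⟩
    · rw [Nat.cast_zero, Real.zero_rpow (by linarith), zero_mul]
      positivity
    · rw [Nat.cast_zero]
      positivity
  rw [Nat.card_Icc] at h
  have h2 : n ≤ 2 * (hyperbolicCross r n γ).card := by omega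
  have h3 : (n : ℝ) ≤ 2 * ((hyperbolicCross r n γ).card : ℝ) := by exact_mod_cast h2
  linarith

theorem half_mul_log_le_card_hyperbolicCross_one {r n : ℕ} (hr : 1 ≤ r) (hn : 2 * r ≤ n) :
    (n : ℝ) / 2 * Real.log (n / (2 * r)) ≤ (hyperbolicCross r n 1).card := by
  have hr0 : (0 : ℝ) < r := by exact_mod_cast hr
  have hn0 : (0 : ℝ) < n := by exact_mod_cast (by omega : 0 < n)
  -- For k ≤ n/(2r) row k has at least ⌊n/k⌋ + 1 - r ≥ n/k - r ≥ n/(2k) points; summing over k gives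
  -- a harmonic number.
  have hfib : ∀ k ∈ Finset.Icc 1 (n / (2 * r)), (n : ℝ) / 2 * (k : ℝ)⁻¹ ≤
      (((hyperbolicCross r n 1).filter fun q => q.1 = k).card : ℝ) := by
    intro k hk
    obtain ⟨hk1, hk2⟩ := Finset.mem_Icc.1 hk
    have hk0 : (0 : ℝ) < k := by exact_mod_cast hk1
    have hkr : k * (2 * r) ≤ n := (Nat.le_div_iff_mul_le (by omega)).1 hk2
    have h : (Finset.Icc r (n / k)).card ≤
        ((hyperbolicCross r n 1).filter fun q => q.1 = k).card := by
      refine Finset.card_le_card_of_injOn (Prod.mk k) (fun j hj => ?_)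
        (Prod.mk_right_injective k).injOn
      obtain ⟨hj1, hj2⟩ := Finset.mem_Icc.1 (Finset.mem_coe.1 hj)
      have hjk : j * k ≤ n := (Nat.le_div_iff_mul_le hk1).1 hj2
      rw [Finset.mem_coe, Finset.mem_filter, mem_hyperbolicCross r n 1 le_rfl]
      refine ⟨⟨?_, ?_, hj1, hj2.trans (Nat.div_le_self _ _)⟩, rfl⟩
      · rw [Real.rpow_one, mul_comm]
        exact_mod_cast hjk
      · rw [one_div_one, Real.rpow_one]
        exact_mod_cast (by nlinarith : k ≤ n)
    rw [Nat.card_Icc] at h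
    have h1 : n / k + 1 ≤ ((hyperbolicCross r n 1).filter fun q => q.1 = k).card + r := by omega
    have h2 : ((n / k : ℕ) : ℝ) + 1 ≤
        (((hyperbolicCross r n 1).filter fun q => q.1 = k).card : ℝ) + r := by exact_mod_cast h1
    have h3 : (n : ℝ) / k ≤ ((n / k : ℕ) : ℝ) + 1 := natCast_div_le_div_add_one n k
    have h4 : (2 * r : ℝ) ≤ n / k := by
      rw [le_div_iff₀ hk0]
      exact_mod_cast (by linarith : 2 * r * k ≤ n)
    have e : (n : ℝ) / 2 * (k : ℝ)⁻¹ = (n : ℝ) / k / 2 := by ring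
    rw [e]
    linarith
  have hle : ∑ k ∈ Finset.Icc 1 (n / (2 * r)),
      (((hyperbolicCross r n 1).filter fun q => q.1 = k).card : ℝ) ≤
      (hyperbolicCross r n 1).card := by
    rw [← Nat.cast_sum, Finset.sum_card_fiberwise_eq_card_filter]
    exact_mod_cast Finset.card_filter_le _ _
  refine le_trans ?_ ((Finset.sum_le_sum hfib).trans hle)
  rw [← Finset.mul_sum]
  gcongr
  have h := log_add_one_le_harmonic (n / (2 * r))
  rw [harmonic_eq_sum_Icc] at h
  push_cast at h
  refine le_trans (Real.log_le_log (by positivity) ?_) h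
  have := natCast_div_le_div_add_one n (2 * r)
  push_cast at this
  exact this

end HyperbolicCross

/-! ### Balancing the parameters and passing between δ, n and N. -/

section Rates

theorem one_le_rpow_neg_inv {δ a : ℝ} (hδ : 0 < δ) (hδ1 : δ < 1) (ha : 0 < a) :
    1 ≤ δ ^ (-(1 / a)) :=
  Real.one_le_rpow_of_pos_of_le_one_of_nonpos hδ hδ1.le (by
    have : 0 < 1 / a := by positivity
    linarith)

theorem rpow_div_eq_rpow_neg {δ a : ℝ} (hδ : 0 < δ) (β : ℝ) :
    δ ^ (β / a) = (δ ^ (-(1 / a))) ^ (-β) := by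
  rw [← Real.rpow_mul hδ.le]
  congr 1
  ring

theorem log_one_div_eq_mul_log {δ a : ℝ} (hδ : 0 < δ) (ha : 0 < a) :
    Real.log (1 / δ) = a * Real.log (δ ^ (-(1 / a))) := by
  rw [Real.log_rpow hδ, one_div δ, Real.log_inv]
  field_simp

theorem le_rpow_neg_inv_of_lt {δ a B : ℝ} (hδ : 0 < δ) (ha : 0 < a) (hB : 0 < B)
    (h : δ < B ^ (-a)) : B ≤ δ ^ (-(1 / a)) := by
  have h1 := Real.rpow_le_rpow_of_nonpos hδ h.le
    (by have : 0 < 1 / a := by positivity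
        linarith : -(1 / a) ≤ 0)
  rw [← Real.rpow_mul hB.le] at h1
  have e : -a * -(1 / a) = 1 := by field_simp
  rwa [e, Real.rpow_one] at h1

/-- Both parts of the error of the truncation method have the order `δ^(β/a)` if the parameter of
the method has the order `δ^(-1/a)`. -/
theorem rpow_add_mul_rpow_le {δ a β c₁ c₂ m : ℝ} (hδ : 0 < δ) (ha : 0 < a) (hβ : 0 < β)
    (hβa : β ≤ a) (hc₁ : 0 < c₁) (hc₂ : 0 < c₂) (h₁ : c₁ * δ ^ (-(1 / a)) ≤ m)
    (h₂ : m ≤ c₂ * δ ^ (-(1 / a))) :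
    m ^ (-β) + δ * m ^ (a - β) ≤ (c₁ ^ (-β) + c₂ ^ (a - β)) * δ ^ (β / a) := by
  have hm : 0 < m := lt_of_lt_of_le (by positivity) h₁
  rw [rpow_div_eq_rpow_neg hδ]
  have hδX : δ = (δ ^ (-(1 / a))) ^ (-a) := by
    rw [← Real.rpow_mul hδ.le]
    have e : -(1 / a) * -a = 1 := by field_simp
    rw [e, Real.rpow_one]
  have hX : 0 < δ ^ (-(1 / a)) := by positivity
  generalize δ ^ (-(1 / a)) = X at *
  rw [add_mul]
  refine add_le_add ?_ ?_
  · rw [← Real.mul_rpow hc₁.le hX.le]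
    exact Real.rpow_le_rpow_of_nonpos (by positivity) h₁ (by linarith)
  · calc δ * m ^ (a - β) ≤ δ * (c₂ * X) ^ (a - β) := by
          have : 0 ≤ a - β := by linarith
          gcongr
      _ = c₂ ^ (a - β) * (X ^ (-a) * X ^ (a - β)) := by
          rw [Real.mul_rpow hc₂.le hX.le, ← hδX]
          ring
      _ = c₂ ^ (a - β) * X ^ (-β) := by
          rw [← Real.rpow_add hX]
          congr 2
          ring

theorem two_mul_max_one_floor_ge (x : ℝ) : x ≤ 2 * max 1 (⌊x⌋₊ : ℝ) := by
  have h1 := (Nat.lt_floor_add_one x).le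
  have h2 := le_max_left 1 (⌊x⌋₊ : ℝ)
  have h3 := le_max_right 1 (⌊x⌋₊ : ℝ)
  linarith

theorem between_floor {d X : ℝ} (hd : 0 < d) (hX : 1 / d ≤ X) :
    Between (d / 2) d (⌊d * X⌋₊ : ℝ) X := by
  have h1 : 1 ≤ d * X := by rwa [div_le_iff₀' hd] at hX
  have h2 : (1 : ℝ) ≤ ⌊d * X⌋₊ := by exact_mod_cast Nat.le_floor (by simpa using h1)
  have h3 := two_mul_max_one_floor_ge (d * X)
  rw [max_eq_right h2] at h3
  exact ⟨by linarith, Nat.floor_le (by linarith)⟩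

/-- The error of the truncation method is bounded by the sum of the orders of the truncation part
and of the noise part. -/
def TruncationBound (r : ℕ) (s μ₁ μ₂ : ℝ) (p : ℝ≥0∞) (a β γ K : ℝ) : Prop :=
  ∀ (n : ℕ) (δ : ℝ), truncationError r s μ₁ μ₂ p δ n γ ≤
    ENNReal.ofReal (K * ((max 1 (n : ℝ)) ^ (-β) + δ * (max 1 (n : ℝ)) ^ (a - β)))

theorem TruncationBound.le_ofReal {r : ℕ} {s μ₁ μ₂ a β γ K c₁ c₂ δ : ℝ} {p : ℝ≥0∞} {n : ℕ}
    (h : TruncationBound r s μ₁ μ₂ p a β γ K) (hK : 0 < K) (ha : 0 < a) (hβ : 0 < β)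
    (hβa : β ≤ a) (hc₁ : 0 < c₁) (hc₂ : 0 < c₂) (hδ : 0 < δ)
    (h₁ : c₁ * δ ^ (-(1 / a)) ≤ max 1 (n : ℝ)) (h₂ : max 1 (n : ℝ) ≤ c₂ * δ ^ (-(1 / a))) :
    truncationError r s μ₁ μ₂ p δ n γ ≤
      ENNReal.ofReal (K * (c₁ ^ (-β) + c₂ ^ (a - β)) * δ ^ (β / a)) := by
  refine (h n δ).trans (ENNReal.ofReal_le_ofReal ?_)
  rw [mul_assoc]
  exact mul_le_mul_of_nonneg_left (rpow_add_mul_rpow_le hδ ha hβ hβa hc₁ hc₂ h₁ h₂) hK.le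

theorem TruncationBound.exists_truncationError_le {r : ℕ} {s μ₁ μ₂ a β γ K : ℝ} {p : ℝ≥0∞}
    (h : TruncationBound r s μ₁ μ₂ p a β γ K) (hK : 0 < K) (ha : 0 < a) (hβ : 0 < β)
    (hβa : β ≤ a) {c₁ : ℝ} (hc₁ : 0 < c₁) (c₂ : ℝ) :
    ∃ C > (0 : ℝ), ∀ (δ : ℝ) (n : ℕ), 0 < δ → δ < 1 →
      Between c₁ c₂ (n : ℝ) (δ ^ (-(1 / a))) →
        truncationError r s μ₁ μ₂ p δ n γ ≤ ENNReal.ofReal (C * δ ^ (β / a)) := by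
  -- The error bound involves max(1, n); since δ^{-1/a} ≥ 1, enlarging c₂ to at least 1 covers the
  -- value 1.
  refine ⟨K * (c₁ ^ (-β) + (max 1 c₂) ^ (a - β)), by positivity, fun δ n hδ hδ1 hn => ?_⟩
  have hX := one_le_rpow_neg_inv hδ hδ1 ha
  refine h.le_ofReal hK ha hβ hβa hc₁ (by positivity) hδ (hn.1.trans (le_max_right _ _)) ?_
  refine max_le ?_ (hn.2.trans (by gcongr; exact le_max_right _ _))
  exact one_le_mul_of_one_le_of_one_le (le_max_left _ _) hX

theorem TruncationBound.exists_minRadius_le {r : ℕ} (hr : 1 ≤ r) {s μ₁ μ₂ a β γ K : ℝ}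
    {p : ℝ≥0∞} (h : TruncationBound r s μ₁ μ₂ p a β γ K) (hγ : 1 < γ) (hK : 0 < K) (ha : 0 < a)
    (hβ : 0 < β) (hβa : β ≤ a) {c₁ c₂ : ℝ} (hc₁ : 0 < c₁) (hc₂ : 0 < c₂) :
    ∃ C > (0 : ℝ), ∀ (δ : ℝ) (N : ℕ), 0 < δ → 1 ≤ N →
      Between c₁ c₂ (N : ℝ) (δ ^ (-(1 / a))) →
        minRadius r s μ₁ μ₂ p N δ ≤ ENNReal.ofReal (C * δ ^ (β / a)) := by
  obtain ⟨D, hD1, hD⟩ := exists_card_hyperbolicCross_le hr hγ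
  have hD0 : 0 < D := by linarith
  -- The cross with n = ⌊N/D⌋ fits the budget N, and the 2 pays for the floor. The case n = 0 is
  -- harmless, so δ need not be small.
  refine ⟨K * ((c₁ / (2 * D)) ^ (-β) + c₂ ^ (a - β)), by positivity, fun δ N hδ hN hNX => ?_⟩
  have hN1 : (1 : ℝ) ≤ N := by exact_mod_cast hN
  have hfl : (⌊(N : ℝ) / D⌋₊ : ℝ) ≤ N / D := Nat.floor_le (by positivity)
  have hcard : (hyperbolicCross r ⌊(N : ℝ) / D⌋₊ γ).card ≤ N := by
    have h1 := hD ⌊(N : ℝ) / D⌋₊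
    have h2 : D * (⌊(N : ℝ) / D⌋₊ : ℝ) ≤ N := by
      rwa [le_div_iff₀' hD0] at hfl
    exact_mod_cast h1.trans h2
  refine (minRadius_le_truncationError hγ.le s μ₁ μ₂ p δ hcard).trans
    (h.le_ofReal hK ha hβ hβa (by positivity) hc₂ hδ ?_ ?_)
  · have h1 := two_mul_max_one_floor_ge ((N : ℝ) / D)
    have h2 : c₁ * δ ^ (-(1 / a)) / D ≤ N / D := by gcongr; exact hNX.1
    have e : c₁ / (2 * D) * δ ^ (-(1 / a)) = c₁ * δ ^ (-(1 / a)) / D / 2 := by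
      field_simp
    rw [e]
    linarith
  · refine (max_le hN1 (hfl.trans (div_le_self (by linarith) hD1))).trans hNX.2

theorem exists_between_card_hyperbolicCross {r : ℕ} (hr : 1 ≤ r) {γ a : ℝ} (hγ : 1 < γ)
    (ha : 0 < a) {c₁ c₂ : ℝ} (hc₁ : 0 < c₁) (hc₂ : 0 < c₂) :
    ∃ C₁ > (0 : ℝ), ∃ C₂ > (0 : ℝ), ∃ δ₀ > (0 : ℝ), ∀ (δ : ℝ) (n : ℕ), 0 < δ → δ < δ₀ →
      Between c₁ c₂ (n : ℝ) (δ ^ (-(1 / a))) →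
        Between C₁ C₂ ((hyperbolicCross r n γ).card : ℝ) (δ ^ (-(1 / a))) := by
  obtain ⟨D, hD1, hD⟩ := exists_card_hyperbolicCross_le hr hγ
  have hr0 : (0 : ℝ) < r := by exact_mod_cast hr
  have hB : 0 < 2 * r / c₁ := by positivity
  refine ⟨c₁ / 2, by positivity, D * c₂, by positivity, (2 * r / c₁) ^ (-a), by positivity,
    fun δ n hδ hδ0 hn => ?_⟩
  have hX := le_rpow_neg_inv_of_lt hδ ha hB hδ0
  rw [div_le_iff₀' hc₁] at hX
  have hn2 : 2 * r ≤ n := by exact_mod_cast hX.trans hn.1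
  refine ⟨?_, ?_⟩
  · have := half_le_card_hyperbolicCross hγ.le hn2
    linarith [hn.1]
  · rw [mul_assoc]
    exact (hD n).trans (by gcongr; exact hn.2)

theorem exists_card_hyperbolicCross_le_budget {r : ℕ} (hr : 1 ≤ r) {γ a : ℝ} (hγ : 1 < γ)
    (ha : 0 < a) {c₁ : ℝ} (hc₁ : 0 < c₁) (c₂ : ℝ) :
    ∃ d₁ > (0 : ℝ), ∃ d₂ > (0 : ℝ), ∃ δ₀ > (0 : ℝ), ∀ (δ : ℝ) (N : ℕ), 0 < δ → δ < δ₀ →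
      Between c₁ c₂ (N : ℝ) (δ ^ (-(1 / a))) →
        ∃ n : ℕ, Between d₁ d₂ (n : ℝ) (δ ^ (-(1 / a))) ∧ (hyperbolicCross r n γ).card ≤ N := by
  obtain ⟨D, hD1, hD⟩ := exists_card_hyperbolicCross_le hr hγ
  have hd : 0 < c₁ / D := by positivity
  refine ⟨c₁ / D / 2, by positivity, c₁ / D, hd, (1 / (c₁ / D)) ^ (-a), by positivity,
    fun δ N hδ hδ0 hN => ?_⟩
  have hb := between_floor hd (le_rpow_neg_inv_of_lt hδ ha (by positivity) hδ0)
  refine ⟨_, hb, ?_⟩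
  have h1 : D * (⌊c₁ / D * δ ^ (-(1 / a))⌋₊ : ℝ) ≤ N := by
    refine le_trans ?_ hN.1
    have := mul_le_mul_of_nonneg_left hb.2 (by linarith : 0 ≤ D)
    refine this.trans (le_of_eq ?_)
    field_simp
  exact_mod_cast (hD _).trans h1

theorem card_hyperbolicCross_one_floor_le {r : ℕ} (hr : 1 ≤ r) {d X : ℝ} (hd : 0 ≤ d)
    (hd1 : d ≤ 1) (hX : 1 ≤ X) :
    ((hyperbolicCross r ⌊d * X⌋₊ 1).card : ℝ) ≤ d * X * (2 + Real.log X) := by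
  have hfl : (⌊d * X⌋₊ : ℝ) ≤ d * X := Nat.floor_le (by positivity)
  have hlogX := Real.log_nonneg hX
  have hlog : Real.log ⌊d * X⌋₊ ≤ Real.log X := by
    rcases Nat.eq_zero_or_pos ⌊d * X⌋₊ with h0 | h0
    · rw [h0, Nat.cast_zero, Real.log_zero]
      exact hlogX
    · exact Real.log_le_log (by exact_mod_cast h0) (hfl.trans (mul_le_of_le_one_left
        (by linarith) hd1))
  refine (card_hyperbolicCross_one_le hr _).trans ?_
  have : 0 ≤ Real.log ⌊d * X⌋₊ := Real.log_natCast_nonneg _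
  gcongr

theorem exists_between_card_hyperbolicCross_one {r : ℕ} (hr : 1 ≤ r) {a : ℝ} (ha : 0 < a)
    {c₁ c₂ : ℝ} (hc₁ : 0 < c₁) (hc₂ : 0 < c₂) :
    ∃ C₁ > (0 : ℝ), ∃ C₂ > (0 : ℝ), ∃ δ₀ > (0 : ℝ), ∀ (δ : ℝ) (n : ℕ), 0 < δ → δ < δ₀ →
      Between c₁ c₂ (n : ℝ) (δ ^ (-(1 / a))) →
        Between C₁ C₂ ((hyperbolicCross r n 1).card : ℝ)
          (δ ^ (-(1 / a)) * Real.log (1 / δ)) := by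
  have hr0 : (0 : ℝ) < r := by exact_mod_cast hr
  set l₁ := |Real.log (c₁ / (2 * r))| with hl₁
  set l₂ := |Real.log c₂| with hl₂
  -- Once X = δ^{-1/a} exceeds B, n ≥ 2r, ln X ≥ 1, and the additive constant ln(c₁/(2r)) is
  -- absorbed by half of ln X.
  set B := max (2 * r / c₁) (Real.exp (max 1 (2 * l₁))) with hB
  have hB0 : 0 < B := by positivity
  refine ⟨c₁ / 4 / a, by positivity, c₂ * (3 + l₂) / a, by positivity, B ^ (-a), by positivity,
    fun δ n hδ hδ0 hn => ?_⟩
  have hXB := le_rpow_neg_inv_of_lt hδ ha hB0 hδ0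
  rw [log_one_div_eq_mul_log hδ ha]
  generalize δ ^ (-(1 / a)) = X at *
  have hX0 : 0 < X := hB0.trans_le hXB
  have hXr : 2 * r ≤ c₁ * X := by
    have := (le_max_left _ _).trans hXB
    rwa [div_le_iff₀' hc₁] at this
  have hlogX : max 1 (2 * l₁) ≤ Real.log X := by
    rw [Real.le_log_iff_exp_le hX0]
    exact (le_max_right _ _).trans hXB
  have hY1 : 1 ≤ Real.log X := (le_max_left _ _).trans hlogX
  have hY2 : 2 * l₁ ≤ Real.log X := (le_max_right _ _).trans hlogX
  have hn2 : 2 * r ≤ n := by exact_mod_cast hXr.trans hn.1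
  have hn0 : (0 : ℝ) < n := by exact_mod_cast (by omega : 0 < n)
  refine ⟨?_, ?_⟩
  · have h1 := half_mul_log_le_card_hyperbolicCross_one hr hn2
    have h2 : Real.log X / 2 ≤ Real.log (n / (2 * r)) := by
      have h3 : Real.log (c₁ / (2 * r) * X) ≤ Real.log (n / (2 * r)) := by
        refine Real.log_le_log (by positivity) ?_
        rw [div_mul_eq_mul_div]
        gcongr
        exact hn.1
      rw [Real.log_mul (by positivity) hX0.ne'] at h3
      have := neg_abs_le (Real.log (c₁ / (2 * r)))
      linarith
    calc c₁ / 4 / a * (X * (a * Real.log X)) = c₁ * X / 2 * (Real.log X / 2) := by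
          field_simp; ring
      _ ≤ n / 2 * Real.log (n / (2 * r)) := by
          have := hn.1
          gcongr
      _ ≤ _ := h1
  · have h2 : Real.log n ≤ l₂ + Real.log X := by
      have := Real.log_le_log hn0 hn.2
      rw [Real.log_mul hc₂.ne' hX0.ne'] at this
      linarith [le_abs_self (Real.log c₂)]
    have hl0 : 0 ≤ l₂ := abs_nonneg _
    calc ((hyperbolicCross r n 1).card : ℝ) ≤ n * (2 + Real.log n) :=
          card_hyperbolicCross_one_le hr n
      _ ≤ c₂ * X * ((3 + l₂) * Real.log X) := by
          have h3 : 2 + Real.log n ≤ (3 + l₂) * Real.log X := by nlinarith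
          have h4 : 0 ≤ Real.log n := Real.log_natCast_nonneg n
          have := hn.2
          gcongr
      _ = _ := by field_simp

theorem exists_card_hyperbolicCross_one_le_budget {r : ℕ} (hr : 1 ≤ r) {a : ℝ} (ha : 0 < a)
    {c₁ : ℝ} (hc₁ : 0 < c₁) (c₂ : ℝ) :
    ∃ d₁ > (0 : ℝ), ∃ d₂ > (0 : ℝ), ∃ δ₀ > (0 : ℝ), ∀ (δ : ℝ) (N : ℕ), 0 < δ → δ < δ₀ →
      Between c₁ c₂ (N : ℝ) (δ ^ (-(1 / a)) * Real.log (1 / δ)) →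
        ∃ n : ℕ, Between d₁ d₂ (n : ℝ) (δ ^ (-(1 / a))) ∧ (hyperbolicCross r n 1).card ≤ N := by
  -- For ln X ≥ 1 one has 2 + ln X ≤ 3 ln X, whence the 3; a enters through ln(1/δ) = a ln X.
  set d := min 1 (c₁ * a / 3) with hd
  have hd0 : 0 < d := lt_min one_pos (by positivity)
  set B := max (1 / d) (Real.exp 1) with hB
  have hB0 : 0 < B := by positivity
  refine ⟨d / 2, by positivity, d, hd0, B ^ (-a), by positivity, fun δ N hδ hδ0 hN => ?_⟩
  have hXB := le_rpow_neg_inv_of_lt hδ ha hB0 hδ0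
  have hN1 := hN.1
  rw [log_one_div_eq_mul_log hδ ha] at hN1
  generalize δ ^ (-(1 / a)) = X at *
  have hX0 : 0 < X := hB0.trans_le hXB
  have hY1 : 1 ≤ Real.log X := by
    rw [Real.le_log_iff_exp_le hX0]
    exact (le_max_right _ _).trans hXB
  have hX1 : 1 ≤ X := by
    have := Real.log_le_sub_one_of_pos hX0
    linarith
  refine ⟨_, between_floor hd0 ((le_max_left _ _).trans hXB), ?_⟩
  have h1 := card_hyperbolicCross_one_floor_le hr hd0.le (min_le_left _ _) hX1
  have h2 : d * X * (2 + Real.log X) ≤ N := by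
    calc d * X * (2 + Real.log X) ≤ c₁ * a / 3 * X * (3 * Real.log X) := by
          have : d ≤ c₁ * a / 3 := min_le_right _ _
          have : 2 + Real.log X ≤ 3 * Real.log X := by linarith
          gcongr
      _ = c₁ * (X * (a * Real.log X)) := by ring
      _ ≤ N := hN1
  exact_mod_cast h1.trans h2

/-- This guards against δ near 1, where ln(1/δ) tends to 0. The requirement N ≥ 2 bounds X ln X from
below, hence also ln X: if ln X ≤ 1 then X ≤ e. -/
theorem exists_le_log_of_le_mul_log {b : ℝ} (hb : 0 < b) :
    ∃ y₀ > (0 : ℝ), ∀ X : ℝ, 1 ≤ X → b ≤ X * Real.log X → y₀ ≤ Real.log X := by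
  refine ⟨min 1 (b / Real.exp 1), lt_min one_pos (by positivity), fun X hX h => ?_⟩
  rcases le_total 1 (Real.log X) with h1 | h1
  · exact (min_le_left _ _).trans h1
  · refine (min_le_right _ _).trans ?_
    have hX0 : 0 < X := by linarith
    have h2 : X ≤ Real.exp 1 := (Real.log_le_iff_le_exp hX0).1 h1
    rw [div_le_iff₀ (Real.exp_pos 1)]
    have := Real.log_nonneg hX
    nlinarith

theorem TruncationBound.exists_minRadius_le_of_log {r : ℕ} (hr : 1 ≤ r) {s μ₁ μ₂ a β K : ℝ}
    {p : ℝ≥0∞} (h : TruncationBound r s μ₁ μ₂ p a β 1 K) (hK : 0 < K) (ha : 0 < a)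
    (hβ : 0 < β) (hβa : β ≤ a) {c₁ c₂ : ℝ} (hc₁ : 0 < c₁) (hc₂ : 0 < c₂) :
    ∃ C > (0 : ℝ), ∀ (δ : ℝ) (N : ℕ), 0 < δ → δ < 1 → 2 ≤ N →
      Between c₁ c₂ (N : ℝ) (δ ^ (-(1 / a)) * Real.log (1 / δ)) →
        minRadius r s μ₁ μ₂ p N δ ≤ ENNReal.ofReal (C * δ ^ (β / a)) := by
  obtain ⟨y₀, hy₀, hlog⟩ := exists_le_log_of_le_mul_log (b := 2 / (c₂ * a)) (by positivity)
  -- Now only ln X ≥ y₀ is known, so 2 + ln X ≤ (2/y₀ + 1) ln X.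
  set d := min 1 (c₁ * a / (2 / y₀ + 1)) with hd
  have hd0 : 0 < d := lt_min one_pos (by positivity)
  refine ⟨K * ((d / 2) ^ (-β) + 1 ^ (a - β)), by positivity, fun δ N hδ hδ1 hN hNX => ?_⟩
  have hX1 := one_le_rpow_neg_inv hδ hδ1 ha
  have hbound := fun n : ℕ => h.le_ofReal (n := n) hK ha hβ hβa (half_pos hd0) one_pos hδ
  obtain ⟨hN1, hN2⟩ := hNX
  rw [log_one_div_eq_mul_log hδ ha] at hN1 hN2
  generalize δ ^ (-(1 / a)) = X at *
  have hX0 : 0 < X := by linarith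
  have hN' : (2 : ℝ) ≤ N := by exact_mod_cast hN
  have hY := hlog X hX1 (by
    rw [div_le_iff₀ (by positivity)]
    linarith)
  have hY0 : 0 < Real.log X := hy₀.trans_le hY
  have hcard : (hyperbolicCross r ⌊d * X⌋₊ 1).card ≤ N := by
    have h1 := card_hyperbolicCross_one_floor_le hr hd0.le (min_le_left _ _) hX1
    have h2 : d * X * (2 + Real.log X) ≤ N := by
      have h3 : 2 + Real.log X ≤ (2 / y₀ + 1) * Real.log X := by
        have : 2 ≤ 2 / y₀ * Real.log X := by
          rw [div_mul_eq_mul_div, le_div_iff₀ hy₀]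
          linarith
        linarith
      calc d * X * (2 + Real.log X)
          ≤ c₁ * a / (2 / y₀ + 1) * X * ((2 / y₀ + 1) * Real.log X) := by
            have : d ≤ c₁ * a / (2 / y₀ + 1) := min_le_right _ _
            gcongr
        _ = c₁ * (X * (a * Real.log X)) := by field_simp
        _ ≤ N := hN1
    exact_mod_cast h1.trans h2
  refine (minRadius_le_truncationError le_rfl s μ₁ μ₂ p δ hcard).trans (hbound _ ?_ ?_)
  · have := two_mul_max_one_floor_ge (d * X)
    linarith
  · rw [one_mul]
    refine max_le hX1 ((Nat.floor_le (by positivity)).trans ?_)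
    exact mul_le_of_le_one_left hX0.le (min_le_left _ _)

/-- If `N ≍ δ^(-1/a) ln(1/δ)` then `N / ln N` is at most of the order of `δ^(-1/a)`. -/
theorem exists_div_log_le {a : ℝ} (ha : 0 < a) {c₁ c₂ : ℝ} (hc₁ : 0 < c₁) (hc₂ : 0 < c₂) :
    ∃ D > (0 : ℝ), ∀ (δ : ℝ) (N : ℕ), 0 < δ → δ < 1 → 2 ≤ N →
      Between c₁ c₂ (N : ℝ) (δ ^ (-(1 / a)) * Real.log (1 / δ)) →
        (N : ℝ) / Real.log N ≤ D * δ ^ (-(1 / a)) := by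
  obtain ⟨y₀, hy₀, hlog⟩ := exists_le_log_of_le_mul_log (b := 2 / (c₂ * a)) (by positivity)
  set B := |Real.log (c₁ * a * y₀)| with hB
  have hB0 : 0 ≤ B := abs_nonneg _
  have hlog2 : 0 < Real.log 2 := Real.log_pos (by norm_num)
  refine ⟨c₂ * a * (1 + B / Real.log 2), by positivity, fun δ N hδ hδ1 hN hNX => ?_⟩
  have hX1 := one_le_rpow_neg_inv hδ hδ1 ha
  obtain ⟨hN1, hN2⟩ := hNX
  rw [log_one_div_eq_mul_log hδ ha] at hN1 hN2
  generalize δ ^ (-(1 / a)) = X at *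
  have hX0 : 0 < X := by linarith
  have hN' : (2 : ℝ) ≤ N := by exact_mod_cast hN
  have hY := hlog X hX1 (by
    rw [div_le_iff₀ (by positivity)]
    linarith)
  have hlogN : Real.log 2 ≤ Real.log N := Real.log_le_log (by norm_num) hN'
  -- N ≥ c₁ a y₀ X gives ln X ≤ ln N + B, and N ≥ 2 absorbs the constant B into a multiple of ln N.
  have h1 : Real.log X ≤ (1 + B / Real.log 2) * Real.log N := by
    have h2 : Real.log (c₁ * a * y₀ * X) ≤ Real.log N := by
      refine Real.log_le_log (by positivity) (le_trans ?_ hN1)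
      calc c₁ * a * y₀ * X ≤ c₁ * a * Real.log X * X := by gcongr
        _ = _ := by ring
    rw [Real.log_mul (by positivity) hX0.ne'] at h2
    have h3 : B ≤ B / Real.log 2 * Real.log N := by
      rw [div_mul_eq_mul_div, le_div_iff₀ hlog2]
      gcongr
    have := neg_abs_le (Real.log (c₁ * a * y₀))
    linarith
  rw [div_le_iff₀ (by linarith)]
  calc (N : ℝ) ≤ c₂ * (X * (a * Real.log X)) := hN2
    _ ≤ c₂ * (X * (a * ((1 + B / Real.log 2) * Real.log N))) := by gcongr
    _ = _ := by ring

theorem exists_minRadius_bounds {r : ℕ} {s μ₁ μ₂ a β : ℝ} {p : ℝ≥0∞} (hβ : 0 < β) {c₂ K : ℝ}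
    (hc₂ : 0 < c₂) (hK : 0 < K)
    (hlow : ∀ (N : ℕ) (δ : ℝ), 1 ≤ N → 0 ≤ δ →
      ENNReal.ofReal (K * (N : ℝ) ^ (-β)) ≤ minRadius r s μ₁ μ₂ p N δ) {c₁ : ℝ} (hc₁ : 0 < c₁)
    (hup : ∃ C > (0 : ℝ), ∀ (δ : ℝ) (N : ℕ), 0 < δ → 1 ≤ N →
      Between c₁ c₂ (N : ℝ) (δ ^ (-(1 / a))) →
        minRadius r s μ₁ μ₂ p N δ ≤ ENNReal.ofReal (C * δ ^ (β / a))) :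
    ∃ C₁ > (0 : ℝ), ∃ C₂ > (0 : ℝ), ∀ (δ : ℝ) (N : ℕ), 0 < δ → δ < 1 →
      Between c₁ c₂ (N : ℝ) (δ ^ (-(1 / a))) →
        (ENNReal.ofReal (C₁ * (N : ℝ) ^ (-β)) ≤ minRadius r s μ₁ μ₂ p N δ ∧
          minRadius r s μ₁ μ₂ p N δ ≤ ENNReal.ofReal (C₂ * (N : ℝ) ^ (-β))) ∧
        (ENNReal.ofReal (C₁ * δ ^ (β / a)) ≤ minRadius r s μ₁ μ₂ p N δ ∧
          minRadius r s μ₁ μ₂ p N δ ≤ ENNReal.ofReal (C₂ * δ ^ (β / a))) := by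
  obtain ⟨C, hC, hup⟩ := hup
  refine ⟨min K (K * c₂ ^ (-β)), by positivity, max C (C * c₂ ^ β), by positivity,
    fun δ N hδ hδ1 hN => ?_⟩
  have hX : 0 < δ ^ (-(1 / a)) := by positivity
  have hN0 : (0 : ℝ) < N := lt_of_lt_of_le (by positivity) hN.1
  have hN1 : 1 ≤ N := by exact_mod_cast hN0
  have hlow := hlow N δ hN1 hδ.le
  have hup := hup δ N hδ hN1 hN
  have hcmp : c₂ ^ (-β) * δ ^ (β / a) ≤ (N : ℝ) ^ (-β) := by
    rw [rpow_div_eq_rpow_neg hδ, ← Real.mul_rpow hc₂.le hX.le]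
    exact Real.rpow_le_rpow_of_nonpos hN0 hN.2 (by linarith)
  have hcmp' : δ ^ (β / a) ≤ c₂ ^ β * (N : ℝ) ^ (-β) := by
    rw [Real.rpow_neg hc₂.le, inv_mul_le_iff₀ (by positivity)] at hcmp
    exact hcmp
  refine ⟨⟨le_trans (ENNReal.ofReal_le_ofReal ?_) hlow,
    hup.trans (ENNReal.ofReal_le_ofReal ?_)⟩,
    le_trans (ENNReal.ofReal_le_ofReal ?_) hlow, hup.trans (ENNReal.ofReal_le_ofReal ?_)⟩
  · gcongr
    exact min_le_left _ _
  · calc C * δ ^ (β / a) ≤ C * (c₂ ^ β * (N : ℝ) ^ (-β)) := by gcongr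
      _ = C * c₂ ^ β * (N : ℝ) ^ (-β) := by ring
      _ ≤ _ := by gcongr; exact le_max_right _ _
  · calc _ ≤ K * c₂ ^ (-β) * δ ^ (β / a) := by gcongr; exact min_le_right _ _
      _ = K * (c₂ ^ (-β) * δ ^ (β / a)) := by ring
      _ ≤ _ := by gcongr
  · gcongr
    exact le_max_left _ _

theorem exists_minRadius_bounds_of_log {r : ℕ} {s μ₁ μ₂ a β : ℝ} {p : ℝ≥0∞} (ha : 0 < a)
    (hβ : 0 < β) {c₁ c₂ K : ℝ} (hc₁ : 0 < c₁) (hc₂ : 0 < c₂) (hK : 0 < K)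
    (hlow : ∀ (N : ℕ) (δ : ℝ), 1 ≤ N → 0 ≤ δ →
      ENNReal.ofReal (K * (N : ℝ) ^ (-β)) ≤ minRadius r s μ₁ μ₂ p N δ)
    (hup : ∃ C > (0 : ℝ), ∀ (δ : ℝ) (N : ℕ), 0 < δ → δ < 1 → 2 ≤ N →
      Between c₁ c₂ (N : ℝ) (δ ^ (-(1 / a)) * Real.log (1 / δ)) →
        minRadius r s μ₁ μ₂ p N δ ≤ ENNReal.ofReal (C * δ ^ (β / a))) :
    ∃ C₁ > (0 : ℝ), ∃ C₂ > (0 : ℝ), ∀ (δ : ℝ) (N : ℕ), 0 < δ → δ < 1 → 2 ≤ N →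
      Between c₁ c₂ (N : ℝ) (δ ^ (-(1 / a)) * Real.log (1 / δ)) →
        (ENNReal.ofReal (C₁ * (N : ℝ) ^ (-β)) ≤ minRadius r s μ₁ μ₂ p N δ ∧
          minRadius r s μ₁ μ₂ p N δ ≤ ENNReal.ofReal (C₂ * ((N : ℝ) / Real.log N) ^ (-β))) ∧
        (ENNReal.ofReal (C₁ * (δ ^ (β / a) * Real.log (1 / δ) ^ (-β))) ≤
            minRadius r s μ₁ μ₂ p N δ ∧
          minRadius r s μ₁ μ₂ p N δ ≤ ENNReal.ofReal (C₂ * δ ^ (β / a))) := by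
  obtain ⟨C, hC, hup⟩ := hup
  obtain ⟨D, hD, hdiv⟩ := exists_div_log_le ha hc₁ hc₂
  refine ⟨min K (K * c₂ ^ (-β)), by positivity, max C (C * D ^ β), by positivity,
    fun δ N hδ hδ1 hN2 hN => ?_⟩
  have hX : 0 < δ ^ (-(1 / a)) := by positivity
  have hL : 0 < Real.log (1 / δ) := Real.log_pos (by rw [lt_div_iff₀ hδ]; linarith)
  have hN' : (2 : ℝ) ≤ N := by exact_mod_cast hN2
  have hN0 : (0 : ℝ) < N := by linarith
  have hlogN : 0 < Real.log N := Real.log_pos (by linarith)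
  have hlow := hlow N δ (by omega) hδ.le
  have hup := hup δ N hδ hδ1 hN2 hN
  have hdiv := hdiv δ N hδ hδ1 hN2 hN
  have hcmp : c₂ ^ (-β) * (δ ^ (β / a) * Real.log (1 / δ) ^ (-β)) ≤ (N : ℝ) ^ (-β) := by
    rw [rpow_div_eq_rpow_neg hδ, ← Real.mul_rpow hX.le hL.le, ← Real.mul_rpow hc₂.le (by positivity)]
    exact Real.rpow_le_rpow_of_nonpos hN0 hN.2 (by linarith)
  have hcmp' : δ ^ (β / a) ≤ D ^ β * ((N : ℝ) / Real.log N) ^ (-β) := by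
    rw [← inv_mul_le_iff₀ (by positivity), ← Real.rpow_neg hD.le, rpow_div_eq_rpow_neg hδ,
      ← Real.mul_rpow hD.le hX.le]
    exact Real.rpow_le_rpow_of_nonpos (by positivity) hdiv (by linarith)
  refine ⟨⟨le_trans (ENNReal.ofReal_le_ofReal ?_) hlow,
    hup.trans (ENNReal.ofReal_le_ofReal ?_)⟩,
    le_trans (ENNReal.ofReal_le_ofReal ?_) hlow, hup.trans (ENNReal.ofReal_le_ofReal ?_)⟩
  · gcongr
    exact min_le_left _ _
  · calc C * δ ^ (β / a) ≤ C * (D ^ β * ((N : ℝ) / Real.log N) ^ (-β)) := by gcongr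
      _ = C * D ^ β * ((N : ℝ) / Real.log N) ^ (-β) := by ring
      _ ≤ _ := by gcongr; exact le_max_right _ _
  · calc _ ≤ K * c₂ ^ (-β) * (δ ^ (β / a) * Real.log (1 / δ) ^ (-β)) := by
          gcongr; exact min_le_right _ _
      _ = K * (c₂ ^ (-β) * (δ ^ (β / a) * Real.log (1 / δ) ^ (-β))) := by ring
      _ ≤ _ := by gcongr
  · gcongr
    exact le_max_left _ _

end Rates

end NumDiff

theorem mainTheorem10 (r : ℕ) (hr : 1 ≤ r) (s μ₁ μ₂ : ℝ) (p : ℝ≥0∞)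
    (hs : 2 ≤ s) (hp : 1 ≤ p)
    (hμ₂ : 2 * (r : ℝ) - 1 / s + 1 / 2 < μ₂) (hμ₁ : μ₂ - 2 * (r : ℝ) < μ₁)
    (a β : ℝ) (ha : a = μ₂ - (1 / p).toReal + 1 / s)
    (hβ : β = μ₂ - 2 * (r : ℝ) + 1 / s - 1 / 2) :
    -- the series defining the derivative converges in `L₂(Q)` on the whole class
    (∀ f ∈ NumDiff.functionClass s μ₁ μ₂, Summable (NumDiff.derivTerm r f)) ∧
    -- part (a): order of the minimal radius when `N ≍ δ^(-1/a)`
    (∀ c₁ > (0 : ℝ), ∀ c₂ > (0 : ℝ), ∃ C₁ > (0 : ℝ), ∃ C₂ > (0 : ℝ),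
      ∀ (δ : ℝ) (N : ℕ), 0 < δ → δ < 1 →
        NumDiff.Between c₁ c₂ (N : ℝ) (δ ^ (-(1 / a))) →
          (ENNReal.ofReal (C₁ * (N : ℝ) ^ (-β)) ≤ NumDiff.minRadius r s μ₁ μ₂ p N δ ∧
            NumDiff.minRadius r s μ₁ μ₂ p N δ ≤ ENNReal.ofReal (C₂ * (N : ℝ) ^ (-β))) ∧
          (ENNReal.ofReal (C₁ * δ ^ (β / a)) ≤ NumDiff.minRadius r s μ₁ μ₂ p N δ ∧
            NumDiff.minRadius r s μ₁ μ₂ p N δ ≤ ENNReal.ofReal (C₂ * δ ^ (β / a)))) ∧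
    -- part (a): the truncation method with `n ≍ δ^(-1/a)` and `γ > 1` is order-optimal
    (∀ γ : ℝ, 1 < γ → γ < (μ₁ + 1 / s - 1 / 2) / β →
      -- its error has the optimal order
      (∀ c₁ > (0 : ℝ), ∀ c₂ > (0 : ℝ), ∃ C > (0 : ℝ), ∀ (δ : ℝ) (n : ℕ), 0 < δ → δ < 1 →
        NumDiff.Between c₁ c₂ (n : ℝ) (δ ^ (-(1 / a))) →
          NumDiff.truncationError r s μ₁ μ₂ p δ n γ ≤ ENNReal.ofReal (C * δ ^ (β / a))) ∧
      -- it uses `≍ δ^(-1/a)` coefficients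
      (∀ c₁ > (0 : ℝ), ∀ c₂ > (0 : ℝ), ∃ C₁ > (0 : ℝ), ∃ C₂ > (0 : ℝ), ∃ δ₀ > (0 : ℝ),
        ∀ (δ : ℝ) (n : ℕ), 0 < δ → δ < δ₀ →
          NumDiff.Between c₁ c₂ (n : ℝ) (δ ^ (-(1 / a))) →
            NumDiff.Between C₁ C₂ ((NumDiff.hyperbolicCross r n γ).card : ℝ) (δ ^ (-(1 / a)))) ∧
      -- and any budget `N ≍ δ^(-1/a)` suffices for some `n ≍ δ^(-1/a)`
      (∀ c₁ > (0 : ℝ), ∀ c₂ > (0 : ℝ), ∃ d₁ > (0 : ℝ), ∃ d₂ > (0 : ℝ), ∃ δ₀ > (0 : ℝ),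
        ∀ (δ : ℝ) (N : ℕ), 0 < δ → δ < δ₀ →
          NumDiff.Between c₁ c₂ (N : ℝ) (δ ^ (-(1 / a))) →
            ∃ n : ℕ, NumDiff.Between d₁ d₂ (n : ℝ) (δ ^ (-(1 / a))) ∧
              (NumDiff.hyperbolicCross r n γ).card ≤ N)) ∧
    -- part (b): bounds for the minimal radius when `N ≍ δ^(-1/a) ln(1/δ)`
    (∀ c₁ > (0 : ℝ), ∀ c₂ > (0 : ℝ), ∃ C₁ > (0 : ℝ), ∃ C₂ > (0 : ℝ),
      ∀ (δ : ℝ) (N : ℕ), 0 < δ → δ < 1 → 2 ≤ N →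
        NumDiff.Between c₁ c₂ (N : ℝ) (δ ^ (-(1 / a)) * Real.log (1 / δ)) →
          (ENNReal.ofReal (C₁ * (N : ℝ) ^ (-β)) ≤ NumDiff.minRadius r s μ₁ μ₂ p N δ ∧
            NumDiff.minRadius r s μ₁ μ₂ p N δ ≤
              ENNReal.ofReal (C₂ * ((N : ℝ) / Real.log N) ^ (-β))) ∧
          (ENNReal.ofReal (C₁ * (δ ^ (β / a) * Real.log (1 / δ) ^ (-β))) ≤
              NumDiff.minRadius r s μ₁ μ₂ p N δ ∧
            NumDiff.minRadius r s μ₁ μ₂ p N δ ≤ ENNReal.ofReal (C₂ * δ ^ (β / a)))) ∧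
    -- part (b): the upper bounds are attained by the truncation method with `γ = 1`
    ((∀ c₁ > (0 : ℝ), ∀ c₂ > (0 : ℝ), ∃ C > (0 : ℝ), ∀ (δ : ℝ) (n : ℕ), 0 < δ → δ < 1 →
        NumDiff.Between c₁ c₂ (n : ℝ) (δ ^ (-(1 / a))) →
          NumDiff.truncationError r s μ₁ μ₂ p δ n 1 ≤ ENNReal.ofReal (C * δ ^ (β / a))) ∧
      (∀ c₁ > (0 : ℝ), ∀ c₂ > (0 : ℝ), ∃ C₁ > (0 : ℝ), ∃ C₂ > (0 : ℝ), ∃ δ₀ > (0 : ℝ),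
        ∀ (δ : ℝ) (n : ℕ), 0 < δ → δ < δ₀ →
          NumDiff.Between c₁ c₂ (n : ℝ) (δ ^ (-(1 / a))) →
            NumDiff.Between C₁ C₂ ((NumDiff.hyperbolicCross r n 1).card : ℝ)
              (δ ^ (-(1 / a)) * Real.log (1 / δ))) ∧
      (∀ c₁ > (0 : ℝ), ∀ c₂ > (0 : ℝ), ∃ d₁ > (0 : ℝ), ∃ d₂ > (0 : ℝ), ∃ δ₀ > (0 : ℝ),
        ∀ (δ : ℝ) (N : ℕ), 0 < δ → δ < δ₀ →
          NumDiff.Between c₁ c₂ (N : ℝ) (δ ^ (-(1 / a)) * Real.log (1 / δ)) →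
            ∃ n : ℕ, NumDiff.Between d₁ d₂ (n : ℝ) (δ ^ (-(1 / a))) ∧
              (NumDiff.hyperbolicCross r n 1).card ≤ N)) := by
  have hr1 : (1 : ℝ) ≤ r := by exact_mod_cast hr
  have hP := NumDiff.toReal_one_div_le_one hp
  have hs0 : 0 < s := by linarith
  have hs1 : 1 / s ≤ 1 / 2 := one_div_le_one_div_of_le two_pos hs
  have hs2 : 0 < 1 / s := by positivity
  have hβ0 : 0 < β := by linarith
  have ha0 : 0 < a := by linarith
  have hβa : β ≤ a := by linarith
  have htr : ∀ γ : ℝ, 1 ≤ γ → γ * β < μ₁ + 1 / s - 1 / 2 →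
      ∃ K : ℝ, 0 < K ∧ NumDiff.TruncationBound r s μ₁ μ₂ p a β γ K := fun γ h1 h2 =>
    NumDiff.exists_truncationError_le r hr hs hp hμ₂ hμ₁ ha hβ h1 h2
  -- Admissibility of γ = 1 is exactly the hypothesis μ₁ > μ₂ - 2r; it also leaves room for some γ >
  -- 1, as part (a) requires.
  have hone : 1 * β < μ₁ + 1 / s - 1 / 2 := by linarith
  obtain ⟨K₀, hK₀, hlow⟩ := NumDiff.exists_le_minRadius r hr μ₁ p hs0
    (by linarith : 0 < μ₂) hβ
  obtain ⟨K₁, hK₁, hK₁'⟩ := htr 1 le_rfl hone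
  refine ⟨fun f hf => NumDiff.summable_derivTerm_of_summable r hr hs hμ₂ hμ₁ hf.1, ?_, ?_, ?_, ?_,
    ?_, ?_⟩
  · intro c₁ hc₁ c₂ hc₂
    have hquot : 1 < (μ₁ + 1 / s - 1 / 2) / β := by
      rwa [lt_div_iff₀ hβ0]
    obtain ⟨γ, hγ1, hγ2⟩ := exists_between hquot
    obtain ⟨K, hK, hK'⟩ := htr γ hγ1.le ((lt_div_iff₀ hβ0).1 hγ2)
    exact NumDiff.exists_minRadius_bounds hβ0 hc₂ hK₀ hlow hc₁
      (hK'.exists_minRadius_le hr hγ1 hK ha0 hβ0 hβa hc₁ hc₂)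
  · intro γ hγ1 hγ2
    obtain ⟨K, hK, hK'⟩ := htr γ hγ1.le ((lt_div_iff₀ hβ0).1 hγ2)
    exact ⟨fun c₁ hc₁ c₂ _ => hK'.exists_truncationError_le hK ha0 hβ0 hβa hc₁ c₂,
      fun c₁ hc₁ c₂ hc₂ => NumDiff.exists_between_card_hyperbolicCross hr hγ1 ha0 hc₁ hc₂,
      fun c₁ hc₁ c₂ _ => NumDiff.exists_card_hyperbolicCross_le_budget hr hγ1 ha0 hc₁ c₂⟩
  · intro c₁ hc₁ c₂ hc₂
    exact NumDiff.exists_minRadius_bounds_of_log ha0 hβ0 hc₁ hc₂ hK₀ hlow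
      (hK₁'.exists_minRadius_le_of_log hr hK₁ ha0 hβ0 hβa hc₁ hc₂)
  · exact fun c₁ hc₁ c₂ _ => hK₁'.exists_truncationError_le hK₁ ha0 hβ0 hβa hc₁ c₂
  · exact fun c₁ hc₁ c₂ hc₂ => NumDiff.exists_between_card_hyperbolicCross_one hr ha0 hc₁ hc₂
  · exact fun c₁ hc₁ c₂ _ => NumDiff.exists_card_hyperbolicCross_one_le_budget hr ha0 hc₁ c₂
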